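/- Consider the planar Newtonian $N$-body problem (gravitational constant $1$). A collision-free solution $X(t)=(\vec r_1(t),\dots,\vec r_N(t))$ for the masses $(m_1,\dots,m_N)$ is called \emph{really perverse} if there is another system of masses $(m_1',\dots,m_N')\neq(m_1,\dots,m_N)$ with the same sum and the same center of mass (at all times) for which $X(t)$ is still a solution. Here masses may be arbitrary real numbers unless their positivity is mentioned, and the equations of motion prescribe the acceleration of every body, $\ddot{\vec r}_i=\sum_{j\ne i}m_j(\vec r_j-\vec r_i)/|\vec r_j-\vec r_i|^3$. For $n\ge 2$ consider the relative equilibria (uniform rotations of a rigid configuration about the origin) of $N=1+3n$ bodies of the following form: a mass $m_0$ at the origin, a regular $n$-gon centered at the origin whose vertices all have mass $m_1$, and a regular $2n$-gon centered at the origin whose vertices have masses alternatively equal to $m_2$ and $m_3$, the two polygons having the same symmetry axes (that is, the directions of a vertex of the $n$-gon and of a vertex of the $2n$-gon differ by a multiple of $\pi/n$). The radii of the two polygons are arbitrary positive numbers. For every $n\ge 237$ there exists a really perverse relative equilibrium of this form. Moreover it can be chosen with $m_0,m_1,m_2,m_3$ all positive, and with another admissible system of masses, of the same sum and the same center of mass,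 which is also of the form $(m_0',m_1',m_2',m_3')$ with all masses positive. For $2\le n\le 236$ no really perverse relative equilibrium of this form exists. -/

import Mathlib

/-- Newton's equations of the planar `N`-body problem (gravitational constant `1`), for the bodies
indexed by `ι` with masses `m`: `X t i` is the position of body `i` at time `t`. There are no
collisions, `X` is twice differentiable, and the acceleration of every body (including bodies of
mass zero, if any) is the Newtonian attraction by the other ones. -/
def IsNBodySolution {ι : Type} [Fintype ι] [DecidableEq ι] (m : ι → ℝ) (X : ℝ → ι → ℂ) : Prop :=
  (∀ t, Function.Injective (X t)) ∧
  ∃ V : ℝ → ι → ℂ, ∀ t i,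
    HasDerivAt (fun s => X s i) (V t i) t ∧
    HasDerivAt (fun s => V s i)
      (∑ j ∈ Finset.univ.erase i, (m j / ‖X t j - X t i‖ ^ 3) • (X t j - X t i)) t

/-- `m` and `m'` are two different admissible systems of masses for the motion `X`, with the same
total mass and, at all times, the same center of mass. -/
def AreReallyAdmissible {ι : Type} [Fintype ι] [DecidableEq ι] (m m' : ι → ℝ)
    (X : ℝ → ι → ℂ) : Prop :=
  IsNBodySolution m X ∧ IsNBodySolution m' X ∧ m' ≠ m ∧
  ∑ i, m' i = ∑ i, m i ∧
  ∀ t, Finset.univ.centerMass m' (X t) = Finset.univ.centerMass m (X t)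

/-- `X` is a really perverse solution of the `N`-body problem with masses `m`: it is still a
solution for some other system of masses with the same total mass and the same center of mass. -/
def IsReallyPerverse {ι : Type} [Fintype ι] [DecidableEq ι] (m : ι → ℝ) (X : ℝ → ι → ℂ) : Prop :=
  ∃ m' : ι → ℝ, AreReallyAdmissible m m' X

/-- The motion `X` is the uniform rotation, about the origin, of the configuration `x`. -/
def IsUniformRotation {ι : Type} (x : ι → ℂ) (X : ℝ → ι → ℂ) : Prop :=
  ∃ ω : ℝ, ∀ t i, X t i = Complex.exp (Complex.I * (ω * t : ℝ)) * x i

/-- The `1 + 3 n` bodies: a central one, the vertices of the `n`-gon, those of the `2n`-gon. -/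
abbrev Body (n : ℕ) : Type := Unit ⊕ (Fin n ⊕ Fin (2 * n))

/-- Central mass `μ 0`, masses `μ 1` on the `n`-gon, masses alternatively `μ 2` and `μ 3` on the
`2n`-gon. -/
def polygonMasses (n : ℕ) (μ : Fin 4 → ℝ) : Body n → ℝ
  | Sum.inl _ => μ 0
  | Sum.inr (Sum.inl _) => μ 1
  | Sum.inr (Sum.inr l) => if Even (l : ℕ) then μ 2 else μ 3

/-- A body at the origin, surrounded by a regular `n`-gon of radius `r` and a regular `2n`-gon of
radius `R`, both centered at the origin. The symmetry axes of the `n`-gon, and those of the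
`2n`-gon with alternating masses, are the `n` lines through the origin and a vertex or the middle
of two successive vertices of the same mass; their directions are multiples of `π / n` from that
of any vertex. Hence the two polygons have the same axes when the directions of their vertices
differ by a multiple of `π / n`. -/
def IsPolygonConfiguration (n : ℕ) (x : Body n → ℂ) : Prop :=
  x (Sum.inl ()) = 0 ∧
  ∃ (r R φ : ℝ) (s : ℤ), 0 < r ∧ 0 < R ∧
    (∀ l : Fin n, x (Sum.inr (Sum.inl l)) =
      r * Complex.exp (Complex.I * (φ + s * Real.pi / n + 2 * Real.pi * (l : ℕ) / n : ℝ))) ∧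
    (∀ l : Fin (2 * n), x (Sum.inr (Sum.inr l)) =
      R * Complex.exp (Complex.I * (φ + 2 * Real.pi * (l : ℕ) / (2 * n) : ℝ)))

section

open Complex

/-! The difference `w` of two admissible systems of masses has total zero and exerts no force on any
body. All vertices lie on the `N = 2n` rays of a regular `N`-gon, so `w` becomes two real functions
on `ZMod N`: `α` for the `n`-gon, supported on one parity class, and `β` for the `2n`-gon. The force
is then a sum of convolutions, diagonalised by the discrete Fourier transform, with real eigenvalues
`attractionDFT N ρ m`.

Signs of eigenvalues decide almost everything. The kernel is `-(1 - z)^(-1/2) (1 - z̄)^(-3/2)`,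
whose expansion has coefficients of one sign, so every eigenvalue is negative for `ρ < 1` and, by
inversion, positive for `ρ > 1`. For `ρ = 1`, discrete convexity and antisymmetry show that the
modes `m < n` are negative and the others positive. The outer equations at `m` and `-m` hence form a
nonsingular 2×2 system for every mode other than `0` and `n`, and these modes of `w` vanish
(`modes_eq_zero`).

What remains is a 3×3 system in `α̂(0)`, `β̂(0)`, `β̂(n)`: the outer modes `0` and `n` and the
equation at one inner vertex, the central mass being eliminated by the zero total. Let `u, v` be the
mode-`0` eigenvalues at `ρ, ρ⁻¹`, let `p, q` be those of mode `n`, and let `c, κ` be those of modes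
`0, n` at radius `1`. Degeneracy means that `(N + c + κ)(N + c)κ - (N + u)(N + v)κ - p q (N + c)`
vanishes. Here `κ > 0`, `(N + u)(N + v) < 0` and `p q < 0`. With `Γ_k` the attraction of a vertex of
the unit `k`-gon by the others (`polygonAttraction`), `N + c = 2n - Γ_{2n}` and `N + c + κ = 2(n -
Γ_n)`.

Now `Γ_k < k` exactly for `2 ≤ k ≤ 472`, because `Γ_k / (k - 1)` is nondecreasing, `Γ_472 < 472` and
`Γ_473 > 473`. If `n ≤ 236`, the whole expression is positive and `w = 0`. If `n ≥ 237`, then `N + c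
< 0`; multiplied by `(1 - ρ)^4`, the expression has opposite signs at `ρ = 0` and `ρ = 1`, so it
vanishes for some radius ratio. The kernel vector at this ratio is added, with a small coefficient,
to an explicit positive relative equilibrium. -/

/-! ### The attraction kernel, its Fourier coefficients and their symmetries. -/

/-- The attraction exerted on a body at `y` by a unit mass at `x` is `y / ‖y‖ ^ 3` times the value
of this function at `x / y`. -/
noncomputable def attraction (z : ℂ) : ℂ := (z - 1) / (‖z - 1‖ : ℂ) ^ 3

/-- The discrete Fourier transform of the attractions exerted on a body at distance `1` of the
center by the vertices of a regular `N`-gon of radius `ρ`. -/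
noncomputable def attractionDFT (N : ℕ) [NeZero N] (ρ : ℝ) (m : ZMod N) : ℂ :=
  ∑ d : ZMod N, attraction (ρ * ZMod.stdAddChar d) * ZMod.stdAddChar (m * d)

theorem attraction_one : attraction 1 = 0 := by simp [attraction]

theorem attraction_zero : attraction 0 = -1 := by simp [attraction]

theorem attraction_conj (z : ℂ) :
    attraction ((starRingEnd ℂ) z) = (starRingEnd ℂ) (attraction z) := by
  have : ‖(starRingEnd ℂ) z - 1‖ = ‖z - 1‖ := by
    rw [← Complex.norm_conj (z - 1)]; simp
  simp [attraction, this]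

theorem attraction_inv {z : ℂ} (hz : z ≠ 0) :
    attraction z = -(z / (‖z‖ : ℂ) ^ 3) * attraction z⁻¹ := by
  have hz' : (‖z‖ : ℂ) ≠ 0 := by simpa using hz
  by_cases h1 : z = 1
  · simp [h1, attraction_one]
  have h2 : z - 1 ≠ 0 := sub_ne_zero.2 h1
  have h3 : (‖z - 1‖ : ℂ) ≠ 0 := by simpa using h2
  have h4 : z⁻¹ - 1 = -(z - 1) / z := by field_simp; ring
  have h5 : ‖z⁻¹ - 1‖ = ‖z - 1‖ / ‖z‖ := by rw [h4, norm_div, norm_neg]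
  rw [attraction, attraction, h5, h4]
  push_cast
  field_simp

theorem norm_stdAddChar {N : ℕ} [NeZero N] (d : ZMod N) :
    ‖(ZMod.stdAddChar d : ℂ)‖ = 1 := AddChar.norm_apply _ d

theorem stdAddChar_neg_eq_inv {N : ℕ} [NeZero N] (d : ZMod N) :
    (ZMod.stdAddChar (-d) : ℂ) = (ZMod.stdAddChar d)⁻¹ := AddChar.map_neg_eq_inv _ d

theorem attractionDFT_conj (N : ℕ) [NeZero N] (ρ : ℝ) (m : ZMod N) :
    (starRingEnd ℂ) (attractionDFT N ρ m) = attractionDFT N ρ m := by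
  unfold attractionDFT
  rw [map_sum, ← Equiv.sum_comp (Equiv.neg (ZMod N))]
  refine Finset.sum_congr rfl fun d _ => ?_
  rw [map_mul, ← attraction_conj, map_mul, ← AddChar.map_neg_eq_conj, ← AddChar.map_neg_eq_conj,
    Complex.conj_ofReal]
  simp

theorem attractionDFT_eq_re (N : ℕ) [NeZero N] (ρ : ℝ) (m : ZMod N) :
    attractionDFT N ρ m = ((attractionDFT N ρ m).re : ℂ) :=
  (Complex.conj_eq_iff_re.1 (attractionDFT_conj N ρ m)).symm

/-- The factor `z / ‖z‖ ^ 3` in `attraction_inv` contributes one extra character, and `d ↦ -d`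
restores the argument: hence the shift `m ↦ -m - 1` rather than a mere change of sign. -/
theorem attractionDFT_inv (N : ℕ) [NeZero N] {ρ : ℝ} (hρ : 0 < ρ) (m : ZMod N) :
    attractionDFT N ρ m = -((ρ : ℂ) ^ 2)⁻¹ * attractionDFT N ρ⁻¹ (-m - 1) := by
  unfold attractionDFT
  rw [← Equiv.sum_comp (Equiv.neg (ZMod N)) (fun d => attraction ((ρ⁻¹ : ℝ) * ZMod.stdAddChar d) * _),
    Finset.mul_sum]
  refine Finset.sum_congr rfl fun d _ => ?_
  have hρ' : (ρ : ℂ) ≠ 0 := by exact_mod_cast hρ.ne'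
  have hd : (ZMod.stdAddChar d : ℂ) ≠ 0 := by
    rw [← norm_ne_zero_iff, norm_stdAddChar]; exact one_ne_zero
  rw [attraction_inv (mul_ne_zero hρ' hd), norm_mul, norm_stdAddChar,
    Complex.norm_real, Real.norm_of_nonneg hρ.le, Equiv.neg_apply, stdAddChar_neg_eq_inv, mul_inv]
  have h1 : (-m - 1) * -d = m * d + d := by ring
  rw [h1, AddChar.map_add_eq_mul]
  push_cast
  field_simp

theorem attractionDFT_inv_re (N : ℕ) [NeZero N] {ρ : ℝ} (hρ : 0 < ρ) (m : ZMod N) :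
    (attractionDFT N ρ m).re = -(ρ ^ 2)⁻¹ * (attractionDFT N ρ⁻¹ (-m - 1)).re := by
  have h := attractionDFT_inv N hρ m
  rw [attractionDFT_eq_re N ρ⁻¹] at h
  rw [h, ← Complex.ofReal_re (-(ρ ^ 2)⁻¹ * (attractionDFT N ρ⁻¹ (-m - 1)).re)]
  push_cast
  rfl

theorem sum_stdAddChar_mul (N : ℕ) [NeZero N] (k : ZMod N) :
    ∑ d : ZMod N, (ZMod.stdAddChar (k * d) : ℂ) = if k = 0 then (N : ℂ) else 0 := by
  have := AddChar.sum_mulShift k (ZMod.isPrimitive_stdAddChar N)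
  simp only [ZMod.card] at this
  simp_rw [mul_comm k]
  rw [this]; split_ifs <;> simp

/-! ### Signs of the Fourier coefficients for radius ratios other than `1`. -/

/-- Functions on `ZMod N` whose Fourier coefficients are nonnegative real numbers. -/
def NonnegDFT (N : ℕ) [NeZero N] (F : ZMod N → ℂ) : Prop :=
  ∀ m, ∃ c : ℝ, 0 ≤ c ∧ ∑ d, F d * ZMod.stdAddChar (m * d) = c

theorem NonnegDFT.const_mul {N : ℕ} [NeZero N] {F : ZMod N → ℂ} (hF : NonnegDFT N F) {c : ℝ}
    (hc : 0 ≤ c) : NonnegDFT N (fun d => c * F d) := by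
  intro m
  obtain ⟨a, ha, h⟩ := hF m
  refine ⟨c * a, mul_nonneg hc ha, ?_⟩
  push_cast
  rw [← h, Finset.mul_sum]
  simp only [mul_assoc]

theorem NonnegDFT.add {N : ℕ} [NeZero N] {F G : ZMod N → ℂ} (hF : NonnegDFT N F)
    (hG : NonnegDFT N G) : NonnegDFT N (fun d => F d + G d) := by
  intro m
  obtain ⟨a, ha, h⟩ := hF m
  obtain ⟨b, hb, h'⟩ := hG m
  refine ⟨a + b, add_nonneg ha hb, ?_⟩
  push_cast
  rw [← h, ← h', ← Finset.sum_add_distrib]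
  simp only [add_mul]

theorem NonnegDFT.hasSum {N : ℕ} [NeZero N] {f : ℕ → ZMod N → ℂ} {F : ZMod N → ℂ}
    (hf : ∀ j, NonnegDFT N (f j)) (h : ∀ d, HasSum (fun j => f j d) (F d)) :
    NonnegDFT N F := by
  intro m
  choose c hc hcf using fun j => hf j m
  have h1 : HasSum (fun j => (c j : ℂ)) (∑ d, F d * ZMod.stdAddChar (m * d)) := by
    simp_rw [← hcf]
    exact hasSum_sum fun d _ => (h d).mul_right _
  have h2 := Complex.hasSum_re h1
  have h3 := Complex.hasSum_im h1
  simp only [Complex.ofReal_re, Complex.ofReal_im] at h2 h3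
  refine ⟨_, h2.nonneg hc, ?_⟩
  apply Complex.ext
  · simp
  · rw [h3.unique hasSum_zero]; simp

theorem nonnegDFT_stdAddChar {N : ℕ} [NeZero N] (k : ZMod N) :
    NonnegDFT N (fun d => ZMod.stdAddChar (k * d)) := by
  intro m
  refine ⟨if k + m = 0 then N else 0, by split_ifs <;> positivity, ?_⟩
  simp_rw [← AddChar.map_add_eq_mul, ← add_mul]
  rw [sum_stdAddChar_mul]
  split_ifs <;> simp

theorem NonnegDFT.eq_sum {N : ℕ} [NeZero N] {F : ZMod N → ℂ} (hF : NonnegDFT N F) :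
    ∃ c : ZMod N → ℝ, (∀ m, 0 ≤ c m) ∧ ∀ d, F d = ∑ m, c m * ZMod.stdAddChar (m * d) := by
  choose c hc h using hF
  have hN : (N : ℂ) ≠ 0 := by exact_mod_cast NeZero.ne N
  refine ⟨fun m => c (-m) / N, fun m => div_nonneg (hc _) (by positivity), fun d => ?_⟩
  push_cast
  simp_rw [← h, Finset.sum_div, Finset.sum_mul]
  rw [Finset.sum_comm]
  have : ∀ d', ∑ m, F d' * (ZMod.stdAddChar (-m * d') : ℂ) / N * ZMod.stdAddChar (m * d)
      = if d' = d then F d else 0 := by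
    intro d'
    have h1 : ∀ m : ZMod N, F d' * (ZMod.stdAddChar (-m * d') : ℂ) / N * ZMod.stdAddChar (m * d)
      = F d' / N * ZMod.stdAddChar ((d - d') * m) := by
      intro m
      have : (d - d') * m = -m * d' + m * d := by ring
      rw [this, AddChar.map_add_eq_mul]; ring
    simp_rw [h1]
    rw [← Finset.mul_sum, sum_stdAddChar_mul]
    by_cases hd : d' = d
    · subst hd; simp
    · rw [if_neg (fun h => hd (sub_eq_zero.1 h).symm), if_neg hd, mul_zero]
  simp_rw [this]
  simp

/-- The transform turns products into convolutions, which preserve nonnegativity. -/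
theorem NonnegDFT.mul {N : ℕ} [NeZero N] {F G : ZMod N → ℂ} (hF : NonnegDFT N F)
    (hG : NonnegDFT N G) : NonnegDFT N (fun d => F d * G d) := by
  obtain ⟨c, hc, h⟩ := hF.eq_sum
  intro m
  choose b hb hb' using hG
  refine ⟨∑ k, c k * b (k + m), Finset.sum_nonneg fun k _ => mul_nonneg (hc k) (hb _), ?_⟩
  push_cast
  simp_rw [← hb', h, Finset.mul_sum, Finset.sum_mul]
  rw [Finset.sum_comm]
  refine Finset.sum_congr rfl fun k _ => Finset.sum_congr rfl fun d _ => ?_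
  rw [add_mul, AddChar.map_add_eq_mul]; ring

theorem NonnegDFT.pow {N : ℕ} [NeZero N] {F : ZMod N → ℂ} (hF : NonnegDFT N F) (j : ℕ) :
    NonnegDFT N (fun d => F d ^ j) := by
  induction j with
  | zero => simpa using nonnegDFT_stdAddChar (N := N) 0
  | succ j ih => simpa only [pow_succ] using ih.mul hF

/-- The terms of degree `0` and `1` are kept out because they are needed exactly: the former gives
the bound `-N` for mode `0`, the latter gives strictness. -/
theorem NonnegDFT.exp_sub {N : ℕ} [NeZero N] {F : ZMod N → ℂ} (hF : NonnegDFT N F) :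
    NonnegDFT N (fun d => exp (F d) - 1 - F d) := by
  refine NonnegDFT.hasSum (f := fun j d => ((((j + 2).factorial : ℝ)⁻¹ : ℝ) : ℂ) * F d ^ (j + 2))
    (fun j => (hF.pow _).const_mul (by positivity)) fun d => ?_
  have h := NormedSpace.expSeries_div_hasSum_exp (F d)
  rw [← Complex.exp_eq_exp_ℂ] at h
  have h2 := (hasSum_nat_add_iff' 2).2 h
  simp only [Finset.sum_range_succ, Finset.sum_range_zero, Nat.factorial] at h2
  convert h2 using 1
  · rfl
  · funext j; push_cast [Nat.factorial]; rw [div_eq_inv_mul]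
  · simp; ring

/-- The Fourier coefficients of `-log (1 - ρ e)` at `m`, where `e` is the standard character, and
of its conjugate, dominate the contribution of the character itself. -/
theorem nonnegDFT_log {N : ℕ} [NeZero N] {ρ : ℝ} (h0 : 0 < ρ) (h1 : ρ < 1) (m : ℕ) :
    NonnegDFT N (fun d => -log (1 - ρ * ZMod.stdAddChar d)
      - ((ρ ^ m / m : ℝ) : ℂ) * ZMod.stdAddChar ((m : ZMod N) * d)) := by
  have hterm : ∀ (d : ZMod N) (j : ℕ), (ρ * ZMod.stdAddChar d : ℂ) ^ j / j =
      ((ρ ^ j / j : ℝ) : ℂ) * ZMod.stdAddChar ((j : ZMod N) * d) := by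
    intro d j
    rw [← nsmul_eq_mul, AddChar.map_nsmul_eq_pow, mul_pow]
    push_cast; ring
  have hs : ∀ d : ZMod N, HasSum (fun j : ℕ => ((ρ ^ j / j : ℝ) : ℂ) *
      ZMod.stdAddChar ((j : ZMod N) * d)) (-log (1 - ρ * ZMod.stdAddChar d)) := by
    intro d
    simp_rw [← hterm]
    apply Complex.hasSum_taylorSeries_neg_log
    rw [norm_mul, norm_stdAddChar, Complex.norm_real, Real.norm_of_nonneg h0.le]; linarith
  refine NonnegDFT.hasSum (f := fun j d => if j = m then 0 else ((ρ ^ j / j : ℝ) : ℂ) *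
      ZMod.stdAddChar ((j : ZMod N) * d)) (fun j => ?_) fun d => ?_
  · by_cases hj : j = m
    · simp only [hj, if_true]
      exact fun _ => ⟨0, le_rfl, by simp⟩
    · simp only [hj, if_false]
      exact (nonnegDFT_stdAddChar _).const_mul (by positivity)
  · have := (hs d).update m 0
    convert this using 1
    · rfl
    · funext j; simp [Function.update_apply]
    · ring

theorem NonnegDFT.conj {N : ℕ} [NeZero N] {F : ZMod N → ℂ} (hF : NonnegDFT N F) :
    NonnegDFT N (fun d => (starRingEnd ℂ) (F d)) := by
  intro m
  obtain ⟨c, hc, h⟩ := hF (-m)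
  refine ⟨c, hc, ?_⟩
  rw [← Complex.conj_ofReal, ← h, map_sum]
  refine Finset.sum_congr rfl fun d _ => ?_
  rw [map_mul (starRingEnd ℂ), ← AddChar.map_neg_eq_conj]; simp

/-- This is `-(1 - z)^(-1/2) (1 - z̄)^(-3/2)`, written as an exponential so that nonnegativity
passes from the logarithmic series to the kernel. -/
theorem attraction_eq_neg_exp {z : ℂ} (hz : ‖z‖ < 1) :
    attraction z = -exp (((1 / 2 : ℝ) : ℂ) * -log (1 - z)
      + ((3 / 2 : ℝ) : ℂ) * (starRingEnd ℂ) (-log (1 - z))) := by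
  have h1 : (1 - z) ≠ 0 := by
    intro h
    rw [← sub_eq_zero.1 h] at hz; simp at hz
  have h2 : ((1 / 2 : ℝ) : ℂ) * -log (1 - z) + ((3 / 2 : ℝ) : ℂ) * (starRingEnd ℂ) (-log (1 - z))
      = log (1 - z) - 3 * ((log (1 - z)).re : ℂ) := by
    apply Complex.ext
    · simp; ring
    · simp; ring
  rw [h2, Complex.exp_sub, Complex.exp_log h1, Complex.log_re]
  have h3 : exp (3 * (Real.log ‖1 - z‖ : ℂ)) = (‖1 - z‖ : ℂ) ^ 3 := by
    rw [show (3 : ℂ) * (Real.log ‖1 - z‖ : ℂ) = (3 : ℕ) * (Real.log ‖1 - z‖ : ℂ) by norm_num,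
      Complex.exp_nat_mul, ← Complex.ofReal_exp, Real.exp_log (norm_pos_iff.2 h1)]
  rw [h3, attraction, ← norm_neg (z - 1), neg_sub, ← neg_div, neg_sub]

theorem attractionDFT_re_lt_neg_ite (N : ℕ) [NeZero N] {ρ : ℝ} (h0 : 0 < ρ) (h1 : ρ < 1) (m : ZMod N) :
    (attractionDFT N ρ m).re < -(if m = 0 then (N : ℝ) else 0) := by
  -- A representative `k` of `-m` for which `ρ ^ k / k` is a genuine positive coefficient: the
  -- corresponding term of the logarithm makes the inequality strict. Adding `N` avoids `k = 0`,
  -- where the quotient would be `0`.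
  obtain ⟨k, hk, hkm⟩ : ∃ k : ℕ, 0 < k ∧ (k : ZMod N) = -m :=
    ⟨(-m).val + N, by have := NeZero.pos N; omega, by simp⟩
  have hL := nonnegDFT_log (N := N) h0 h1 k
  have hc : 0 < ρ ^ k / k := by positivity
  set c := ρ ^ k / k with hcdef
  have hN : (0 : ℝ) < N := by exact_mod_cast NeZero.pos N
  set L : ZMod N → ℂ := fun d => -log (1 - ρ * ZMod.stdAddChar d) with hLdef
  have hLpos : NonnegDFT N L := by
    have := hL.add ((nonnegDFT_stdAddChar (N := N) k).const_mul hc.le)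
    simpa using this
  have hF := (hLpos.const_mul (c := 1 / 2) (by norm_num)).add
    (hLpos.conj.const_mul (c := 3 / 2) (by norm_num))
  obtain ⟨a, ha, hae⟩ := hF.exp_sub m
  obtain ⟨b, hb, hbe⟩ := (hL.const_mul (c := 1 / 2) (by norm_num)) m
  obtain ⟨b', hb', hbe'⟩ := (hLpos.conj.const_mul (c := 3 / 2) (by norm_num)) m
  have key : attractionDFT N ρ m = ((-(if m = 0 then (N : ℝ) else 0) - a - b - b'
      - 1 / 2 * c * N : ℝ) : ℂ) := by
    have h2 : (((if m = 0 then (N : ℝ) else 0) : ℝ) : ℂ) =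
        ∑ d : ZMod N, (ZMod.stdAddChar (m * d) : ℂ) := by
      rw [sum_stdAddChar_mul]; split_ifs <;> simp
    have h3 : ((1 / 2 * c * N : ℝ) : ℂ) = ∑ d : ZMod N, ((1 / 2 : ℝ) : ℂ) * ((c : ℂ) *
        ZMod.stdAddChar ((k : ZMod N) * d)) * ZMod.stdAddChar (m * d) := by
      have : ∀ d : ZMod N, ((1 / 2 : ℝ) : ℂ) * ((c : ℂ) * ZMod.stdAddChar ((k : ZMod N) * d))
          * ZMod.stdAddChar (m * d) = ((1 / 2 : ℝ) : ℂ) * c := by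
        intro d
        rw [mul_assoc, mul_assoc, ← AddChar.map_add_eq_mul, hkm]
        simp
      simp_rw [this]
      simp; ring
    rw [Complex.ofReal_sub, Complex.ofReal_sub, Complex.ofReal_sub, Complex.ofReal_sub,
      Complex.ofReal_neg, h2, h3, ← hae, ← hbe, ← hbe', ← Finset.sum_neg_distrib,
      ← Finset.sum_sub_distrib, ← Finset.sum_sub_distrib, ← Finset.sum_sub_distrib,
      ← Finset.sum_sub_distrib, attractionDFT]
    refine Finset.sum_congr rfl fun d _ => ?_
    have hz : ‖(ρ : ℂ) * ZMod.stdAddChar d‖ < 1 := by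
      rw [norm_mul, norm_stdAddChar, Complex.norm_real, Real.norm_of_nonneg h0.le]; linarith
    rw [attraction_eq_neg_exp hz]
    simp only [hLdef]
    ring
  rw [key, Complex.ofReal_re]
  have : 0 < 1 / 2 * c * N := by positivity
  linarith

theorem attractionDFT_re_neg (N : ℕ) [NeZero N] {ρ : ℝ} (h0 : 0 < ρ) (h1 : ρ < 1) (m : ZMod N) :
    (attractionDFT N ρ m).re < 0 := by
  refine (attractionDFT_re_lt_neg_ite N h0 h1 m).trans_le ?_
  split_ifs <;> simp

theorem attractionDFT_zero_re_lt (N : ℕ) [NeZero N] {ρ : ℝ} (h0 : 0 < ρ) (h1 : ρ < 1) :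
    (attractionDFT N ρ 0).re < -N := by
  simpa using attractionDFT_re_lt_neg_ite N h0 h1 0

theorem attractionDFT_re_pos (N : ℕ) [NeZero N] {ρ : ℝ} (h1 : 1 < ρ) (m : ZMod N) :
    0 < (attractionDFT N ρ m).re := by
  have h0 : 0 < ρ := by linarith
  rw [attractionDFT_inv_re N h0]
  have := attractionDFT_re_neg N (inv_pos.2 h0) (inv_lt_one_of_one_lt₀ h1) (-m - 1)
  have h2 : 0 < (ρ ^ 2)⁻¹ := by positivity
  nlinarith [mul_pos_of_neg_of_neg (neg_neg_of_pos h2) this]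

/-! ### Signs of the Fourier coefficients at radius ratio `1`. -/

theorem sum_zmod_eq_sum_range {M : Type*} [AddCommMonoid M] (N : ℕ) [NeZero N] (f : ZMod N → M) :
    ∑ d, f d = ∑ l ∈ Finset.range N, f l :=
  Finset.sum_nbij' (fun d => d.val) (fun l => (l : ZMod N))
    (fun d _ => Finset.mem_range.2 d.val_lt) (fun _ _ => Finset.mem_univ _) (fun d _ => by simp)
    (fun l hl => by simpa using ZMod.val_cast_of_lt (Finset.mem_range.1 hl)) (fun d _ => by simp)

theorem stdAddChar_natCast {N : ℕ} [NeZero N] (l : ℕ) :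
    (ZMod.stdAddChar (l : ZMod N) : ℂ) = exp ((2 * (Real.pi * l / N) : ℝ) * I) := by
  have := ZMod.stdAddChar_coe (N := N) (l : ℤ)
  rw [Int.cast_natCast] at this
  rw [this]; congr 1; push_cast; ring

theorem sin_pi_mul_div_pos {N l : ℕ} (h0 : 0 < l) (h1 : l < N) : 0 < Real.sin (Real.pi * l / N) := by
  have h0' : (0 : ℝ) < l := by exact_mod_cast h0
  have h1' : (l : ℝ) < N := by exact_mod_cast h1
  have hN : (0 : ℝ) < N := h0'.trans h1'
  apply Real.sin_pos_of_pos_of_lt_pi (by positivity)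
  rw [div_lt_iff₀ hN]
  exact mul_lt_mul_of_pos_left h1' Real.pi_pos

theorem attraction_exp {φ : ℝ} (h : 0 < Real.sin φ) :
    attraction (exp ((2 * φ : ℝ) * I)) = I * exp (φ * I) / (4 * (Real.sin φ : ℂ) ^ 2) := by
  have hs : (Real.sin φ : ℂ) ≠ 0 := by exact_mod_cast h.ne'
  have h1 : exp ((2 * φ : ℝ) * I) - 1 = 2 * Real.sin φ * (I * exp (φ * I)) := by
    have h2 : exp ((2 * φ : ℝ) * I) = exp (φ * I) * exp (φ * I) := by
      rw [← Complex.exp_add]; congr 1; push_cast; ring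
    have h3 : (1 : ℂ) = exp (φ * I) * exp (-φ * I) := by
      rw [← Complex.exp_add]; simp
    rw [h2, Complex.ofReal_sin, Complex.sin]
    linear_combination -h3 - (exp (φ * I) * exp (-φ * I) - exp (φ * I) * exp (φ * I)) * Complex.I_sq
  have h4 : ‖exp ((2 * φ : ℝ) * I) - 1‖ = 2 * Real.sin φ := by
    rw [h1, norm_mul, norm_mul, norm_mul, Complex.norm_exp_ofReal_mul_I, Complex.norm_real,
      Real.norm_of_nonneg h.le]
    simp
  rw [attraction, h4, h1]
  push_cast at hs ⊢
  field_simp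
  norm_num

theorem attractionDFT_one_re (N : ℕ) [NeZero N] (m : ℕ) :
    (attractionDFT N 1 m).re = -(1 / 4) * ∑ l ∈ Finset.Ico 1 N,
      Real.sin ((2 * m + 1) * (Real.pi * l / N)) / Real.sin (Real.pi * l / N) ^ 2 := by
  rw [attractionDFT, sum_zmod_eq_sum_range, Finset.range_eq_Ico,
    Finset.sum_eq_sum_Ico_succ_bot (NeZero.pos N)]
  simp only [Nat.cast_zero, AddChar.map_zero_eq_one, Complex.ofReal_one, mul_one, attraction_one,
    zero_mul, zero_add, one_mul]
  rw [Complex.re_sum, Finset.mul_sum]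
  refine Finset.sum_congr rfl fun l hl => ?_
  have hl' := Finset.mem_Ico.1 hl
  rw [← Nat.cast_mul, stdAddChar_natCast, stdAddChar_natCast,
    attraction_exp (sin_pi_mul_div_pos hl'.1 hl'.2)]
  set φ := Real.pi * l / N with hφ
  have h1 : (I * exp (φ * I) / (4 * (Real.sin φ : ℂ) ^ 2)) *
      exp ((2 * (Real.pi * (m * l : ℕ) / N) : ℝ) * I)
      = I * (exp (((2 * m + 1) * φ : ℝ) * I) * ((1 / 4 * (Real.sin φ ^ 2)⁻¹ : ℝ) : ℂ)) := by
    have : exp (((2 * m + 1) * φ : ℝ) * I) = exp (φ * I) *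
        exp ((2 * (Real.pi * (m * l : ℕ) / N) : ℝ) * I) := by
      rw [← Complex.exp_add, hφ]; congr 1; push_cast; ring
    rw [this]
    push_cast
    field_simp
  rw [h1, Complex.I_mul_re, Complex.im_mul_ofReal, Complex.exp_ofReal_mul_I_im]
  ring

theorem sum_sin_mul (N : ℕ) (θ : ℝ) : 2 * Real.sin (θ / 2) * ∑ l ∈ Finset.range N,
    Real.sin (θ * l) = Real.cos (θ / 2) - Real.cos (θ * N - θ / 2) := by
  induction N with
  | zero => simp
  | succ N ih =>
    rw [Finset.sum_range_succ, mul_add, ih]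
    push_cast
    have h1 : θ * (N + 1) - θ / 2 = θ * N + θ / 2 := by ring
    rw [h1, Real.cos_add, Real.cos_sub]; ring

/-- Discrete convexity of the sums in `attractionDFT_one_re`. -/
theorem attractionDFT_one_second_difference (n : ℕ) (m : ℕ) [NeZero (2 * n)] (hm : m + 1 < n) :
    2 * (attractionDFT (2 * n) 1 (m + 1 : ℕ)).re <
      (attractionDFT (2 * n) 1 (m + 2 : ℕ)).re + (attractionDFT (2 * n) 1 m).re := by
  have hn : (0 : ℝ) < n := by exact_mod_cast (by omega : 0 < n)
  have hm' : (m : ℝ) + 1 + 1 ≤ n := by exact_mod_cast hm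
  set θ : ℝ := (2 * m + 3) * Real.pi / (2 * n) with hθ
  -- The second difference of `sin ((2 * m + 1) * φ)` in `m` is `-4 * sin φ ^ 2 * sin ((2 * m + 3) *
  -- φ)`, which cancels the denominator. The remaining sum equals `cot (θ / 2)`, with `0 < θ / 2 < π
  -- / 2`.
  have key : (attractionDFT (2 * n) 1 (m + 2 : ℕ)).re + (attractionDFT (2 * n) 1 m).re -
      2 * (attractionDFT (2 * n) 1 (m + 1 : ℕ)).re = ∑ l ∈ Finset.range (2 * n), Real.sin (θ * l) := by
    rw [attractionDFT_one_re, attractionDFT_one_re, attractionDFT_one_re, Finset.range_eq_Ico,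
      Finset.sum_eq_sum_Ico_succ_bot (by omega : 0 < 2 * n), Finset.mul_sum, Finset.mul_sum,
      Finset.mul_sum, Finset.mul_sum, ← Finset.sum_add_distrib, ← Finset.sum_sub_distrib]
    simp only [Nat.cast_zero, mul_zero, Real.sin_zero, zero_add]
    refine Finset.sum_congr rfl fun l hl => ?_
    have hl' := Finset.mem_Ico.1 hl
    have hs := sin_pi_mul_div_pos hl'.1 hl'.2
    set φ := Real.pi * l / (2 * n : ℕ) with hφ
    have e0 : θ * l = (2 * m + 3) * φ := by rw [hθ, hφ]; push_cast; field_simp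
    have e1 : (2 * ((m + 2 : ℕ) : ℝ) + 1) * φ = (2 * m + 3) * φ + 2 * φ := by push_cast; ring
    have e2 : (2 * (m : ℝ) + 1) * φ = (2 * m + 3) * φ - 2 * φ := by ring
    have e3 : (2 * ((m + 1 : ℕ) : ℝ) + 1) * φ = (2 * m + 3) * φ := by push_cast; ring
    rw [e0, e1, e2, e3, Real.sin_add, Real.sin_sub, Real.cos_two_mul, Real.cos_sq']
    field_simp
    ring
  have h2 := sum_sin_mul (2 * n) θ
  have e : θ * (2 * n : ℕ) - θ / 2 = Real.pi - θ / 2 + (m + 1 : ℕ) * (2 * Real.pi) := by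
    rw [hθ]; push_cast; field_simp; ring
  rw [e, Real.cos_add_nat_mul_two_pi, Real.cos_pi_sub, ← key] at h2
  have hθ0 : 0 < θ / 2 := by positivity
  have hθ1 : θ / 2 < Real.pi / 2 := by
    rw [hθ, div_div, div_lt_div_iff₀ (by positivity) (by norm_num)]
    nlinarith [Real.pi_pos]
  have hs := Real.sin_pos_of_pos_of_lt_pi hθ0 (by linarith)
  have hc := Real.cos_pos_of_mem_Ioo ⟨by linarith, hθ1⟩
  have : 0 < 2 * Real.sin (θ / 2) * ((attractionDFT (2 * n) 1 (m + 2 : ℕ)).re +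
      (attractionDFT (2 * n) 1 m).re - 2 * (attractionDFT (2 * n) 1 (m + 1 : ℕ)).re) := by
    rw [h2]; linarith
  have := (mul_pos_iff_of_pos_left (by positivity)).1 this
  linarith

theorem attractionDFT_one_antisymm (N : ℕ) [NeZero N] (m : ZMod N) :
    (attractionDFT N 1 (-m - 1)).re = -(attractionDFT N 1 m).re := by
  have := attractionDFT_inv_re N one_pos m
  simp at this
  linarith

theorem attractionDFT_one_zero_re_neg (N : ℕ) [NeZero N] (hN : 2 ≤ N) :
    (attractionDFT N 1 0).re < 0 := by
  have := attractionDFT_one_re N 0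
  simp only [Nat.cast_zero] at this
  rw [this]
  have : 0 < ∑ l ∈ Finset.Ico 1 N,
      Real.sin ((2 * 0 + 1) * (Real.pi * l / N)) / Real.sin (Real.pi * l / N) ^ 2 := by
    refine Finset.sum_pos (fun l hl => ?_) ⟨1, by simp; omega⟩
    have hl' := Finset.mem_Ico.1 hl
    have hs := sin_pi_mul_div_pos hl'.1 hl'.2
    simp only [mul_zero, zero_add, one_mul]
    positivity
  linarith

/-- A sequence which is convex on `[0, n]`, negative at `0`, and antisymmetric about
`n - 1 / 2`, is negative on `[0, n - 1]`. -/
theorem neg_of_convex_of_antisymm {n : ℕ} {g : ℕ → ℝ} (h0 : g 0 < 0)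
    (hc : ∀ m, m + 1 < n → 2 * g (m + 1) < g (m + 2) + g m) (ha : g n = -g (n - 1)) :
    ∀ m, m < n → g m < 0 := by
  have mono : ∀ k j, j + k + 1 ≤ n → g (j + 1) - g j ≤ g (j + k + 1) - g (j + k) := by
    intro k j
    induction k with
    | zero => intro _; simp
    | succ k ih =>
      intro h
      have h1 := ih (by omega)
      have h2 := hc (j + k) (by omega)
      have e : g (j + (k + 1) + 1) = g (j + k + 2) := rfl
      have e' : g (j + (k + 1)) = g (j + k + 1) := rfl
      rw [e, e']; linarith
  by_contra! hcon
  obtain ⟨m, hm, hgm⟩ := hcon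
  -- A nonnegative value forces a positive increment before it. By convexity all later increments
  -- are positive, so `g (n - 1) ≥ 0` and `g n > g (n - 1)`, against antisymmetry.
  obtain ⟨j, hj, hjm⟩ : ∃ j, j < m ∧ 0 < g (j + 1) - g j := by
    by_contra! hno
    have : ∀ j, j ≤ m → g j ≤ g 0 := by
      intro j
      induction j with
      | zero => simp
      | succ j ih =>
        intro h
        have := ih (by omega)
        have := hno j (by omega)
        linarith
    linarith [this m le_rfl]
  have up : ∀ k, m + k ≤ n - 1 → 0 ≤ g (m + k) := by
    intro k
    induction k with
    | zero => intro _; exact hgm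
    | succ k ih =>
      intro h
      have h1 := ih (by omega)
      have h2 := mono (m + k - j) j (by omega)
      rw [show j + (m + k - j) = m + k by omega] at h2
      rw [← add_assoc]; linarith
  have h1 := up (n - 1 - m) (by omega)
  rw [show m + (n - 1 - m) = n - 1 by omega] at h1
  have h2 := mono (n - 1 - j) j (by omega)
  rw [show j + (n - 1 - j) = n - 1 by omega, show n - 1 + 1 = n by omega, ha] at h2
  linarith

theorem attractionDFT_one_re_neg (n : ℕ) [NeZero (2 * n)] (m : ℕ) (hm : m < n) :
    (attractionDFT (2 * n) 1 m).re < 0 := by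
  refine neg_of_convex_of_antisymm (g := fun m => (attractionDFT (2 * n) 1 m).re) ?_
    (fun m hm => attractionDFT_one_second_difference n m hm) ?_ m hm
  · simpa using attractionDFT_one_zero_re_neg (2 * n) (by omega)
  · rw [← attractionDFT_one_antisymm]
    congr 2
    have h1 : ((2 * n : ℕ) : ZMod (2 * n)) = 0 := ZMod.natCast_self _
    push_cast [Nat.cast_sub (by omega : 1 ≤ n)] at h1 ⊢
    linear_combination h1

theorem attractionDFT_one_re_pos (n : ℕ) [NeZero (2 * n)] (m : ℕ) (hm : n ≤ m) (hm' : m < 2 * n) :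
    0 < (attractionDFT (2 * n) 1 m).re := by
  have h := attractionDFT_one_re_neg n (2 * n - 1 - m) (by omega)
  have h2 := attractionDFT_one_antisymm (2 * n) ((2 * n - 1 - m : ℕ) : ZMod (2 * n))
  have e : -((2 * n - 1 - m : ℕ) : ZMod (2 * n)) - 1 = m := by
    have h1 : ((2 * n : ℕ) : ZMod (2 * n)) = 0 := ZMod.natCast_self _
    rw [Nat.sub_sub, Nat.cast_sub (by omega)]
    push_cast at h1 ⊢
    linear_combination -h1
  rw [e] at h2
  linarith

/-! ### The self-attraction of a regular polygon and its growth. -/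

/-- The attraction of a vertex of a regular `N`-gon of radius `1` by the other vertices, which
have mass `1`. -/
noncomputable def polygonAttraction (N : ℕ) : ℝ :=
  1 / 4 * ∑ l ∈ Finset.Ico 1 N, 1 / Real.sin (Real.pi * l / N)

theorem attractionDFT_one_zero_re (N : ℕ) [NeZero N] :
    (attractionDFT N 1 0).re = -polygonAttraction N := by
  have := attractionDFT_one_re N 0
  simp only [Nat.cast_zero] at this
  rw [this, polygonAttraction, neg_mul]
  congr 2
  refine Finset.sum_congr rfl fun l hl => ?_
  have hl' := Finset.mem_Ico.1 hl
  have hs := sin_pi_mul_div_pos hl'.1 hl'.2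
  simp only [mul_zero, zero_add, one_mul]
  field_simp

theorem sum_range_two_mul_even {M : Type*} [AddCommMonoid M] (n : ℕ) (f : ℕ → M) :
    ∑ l ∈ Finset.range (2 * n), (if Even l then f l else 0) =
      ∑ l ∈ Finset.range n, f (2 * l) := by
  induction n with
  | zero => simp
  | succ n ih =>
    rw [show 2 * (n + 1) = 2 * n + 1 + 1 by ring, Finset.sum_range_succ, Finset.sum_range_succ, ih,
      Finset.sum_range_succ]
    simp

/-- Mode `n` inserts the signs `(-1) ^ l` in the cosecant sum, and its terms of even index form the
sum of the `n`-gon. -/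
theorem attractionDFT_one_half_re (n : ℕ) [NeZero (2 * n)] :
    (attractionDFT (2 * n) 1 n).re = polygonAttraction (2 * n) - 2 * polygonAttraction n := by
  have hn : 0 < n := by have := NeZero.pos (2 * n); omega
  have hn' : (0 : ℝ) < n := by exact_mod_cast hn
  have h1 := sum_range_two_mul_even n (fun l => 1 / Real.sin (Real.pi * l / (2 * n : ℕ)))
  rw [Finset.range_eq_Ico, Finset.range_eq_Ico,
    Finset.sum_eq_sum_Ico_succ_bot (by omega : 0 < 2 * n),
    Finset.sum_eq_sum_Ico_succ_bot (by omega : 0 < n)] at h1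
  have h2 : polygonAttraction n = 1 / 4 * ∑ l ∈ Finset.Ico 1 (2 * n),
      (if Even l then 1 / Real.sin (Real.pi * l / (2 * n : ℕ)) else 0) := by
    simp at h1
    rw [polygonAttraction]
    simp only [one_div, Nat.cast_mul, Nat.cast_ofNat]
    rw [h1]
    congr 1
    refine Finset.sum_congr rfl fun l hl => ?_
    congr 2
    field_simp
  rw [h2, polygonAttraction, attractionDFT_one_re, Finset.mul_sum, Finset.mul_sum, Finset.mul_sum,
    Finset.mul_sum, ← Finset.sum_sub_distrib]
  refine Finset.sum_congr rfl fun l hl => ?_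
  have hl' := Finset.mem_Ico.1 hl
  have hs := sin_pi_mul_div_pos hl'.1 hl'.2
  have e : (2 * (n : ℝ) + 1) * (Real.pi * l / (2 * n : ℕ)) =
      Real.pi * l / (2 * n : ℕ) + l * Real.pi := by
    push_cast; field_simp; ring
  rw [e, Real.sin_add_nat_mul_pi]
  by_cases hl2 : Even l
  · rw [hl2.neg_one_pow, if_pos hl2]; field_simp; ring
  · rw [(Nat.not_even_iff_odd.1 hl2).neg_one_pow, if_neg hl2]; field_simp; ring

theorem inv_sin_convex {x y l : ℝ} (hx : x ∈ Set.Ioo 0 Real.pi) (hy : y ∈ Set.Ioo 0 Real.pi)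
    (h0 : 0 ≤ l) (h1 : l ≤ 1) :
    1 / Real.sin ((1 - l) * x + l * y) ≤ (1 - l) * (1 / Real.sin x) + l * (1 / Real.sin y) := by
  have hA := Real.sin_pos_of_mem_Ioo hx
  have hB := Real.sin_pos_of_mem_Ioo hy
  have hc := strictConcaveOn_sin_Icc.concaveOn.2 (Set.Ioo_subset_Icc_self hx)
    (Set.Ioo_subset_Icc_self hy) (sub_nonneg.2 h1) h0 (by ring)
  simp only [smul_eq_mul] at hc
  set A := Real.sin x
  set B := Real.sin y
  have hm : 0 < (1 - l) * A + l * B := by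
    rcases h0.eq_or_lt with h | h
    · rw [← h]; simpa using hA
    · have := mul_pos h hB
      have := mul_nonneg (sub_nonneg.2 h1) hA.le
      linarith
  refine (one_div_le_one_div_of_le hm hc).trans ?_
  rw [mul_one_div, mul_one_div, div_add_div _ _ hA.ne' hB.ne', div_le_div_iff₀ hm (mul_pos hA hB)]
  nlinarith [mul_nonneg (mul_nonneg h0 (sub_nonneg.2 h1)) (sq_nonneg (A - B))]

/-- The point `k / N` divides `[k / (N + 1), (k + 1) / (N + 1)]` with weights `1 - k / N` and `k /
N`. Convexity of the cosecant bounds each term, and after summation every interior value at the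
finer nodes has total weight `N - 1`. -/
theorem mul_polygonAttraction_le_succ (N : ℕ) (hN : 1 ≤ N) :
    N * polygonAttraction N ≤ (N - 1) * polygonAttraction (N + 1) := by
  have hN' : (0 : ℝ) < N := by exact_mod_cast hN
  set f : ℕ → ℝ := fun k => 1 / Real.sin (Real.pi * k / (N + 1 : ℕ)) with hf
  have hmem : ∀ j : ℕ, 1 ≤ j → j ≤ N → Real.pi * j / (N + 1 : ℕ) ∈ Set.Ioo 0 Real.pi := by
    intro j h1 h2
    have h1' : (0 : ℝ) < j := by exact_mod_cast h1
    have h2' : (j : ℝ) < (N + 1 : ℕ) := by exact_mod_cast Nat.lt_succ_of_le h2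
    refine ⟨by have := Real.pi_pos; positivity, ?_⟩
    rw [div_lt_iff₀ (by positivity)]
    exact mul_lt_mul_of_pos_left h2' Real.pi_pos
  have hstep : ∀ k ∈ Finset.Ico 1 N, N * (1 / Real.sin (Real.pi * k / N)) ≤
      (N - k) * f k + k * f (k + 1) := by
    intro k hk
    have hk' := Finset.mem_Ico.1 hk
    have hkN : (k : ℝ) ≤ N := by exact_mod_cast hk'.2.le
    have := inv_sin_convex (hmem k hk'.1 hk'.2.le) (hmem (k + 1) (by omega) (by omega))
      (l := k / N) (by positivity) (div_le_one_of_le₀ hkN hN'.le)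
    have e : (1 - (k : ℝ) / N) * (Real.pi * k / (N + 1 : ℕ)) +
        k / N * (Real.pi * (k + 1 : ℕ) / (N + 1 : ℕ)) = Real.pi * k / N := by
      push_cast; field_simp; ring
    rw [e] at this
    refine (mul_le_mul_of_nonneg_left this hN'.le).trans_eq ?_
    simp only [hf]
    field_simp
  have hsum := Finset.sum_le_sum hstep
  rw [← Finset.mul_sum] at hsum
  have htel : ∀ M : ℕ, ∑ k ∈ Finset.range M, ((N - k) * f k + k * f (k + 1)) =
      (N - 1) * ∑ k ∈ Finset.range M, f k + M * f M + f 0 - f M := by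
    intro M
    induction M with
    | zero => simp
    | succ M ih => rw [Finset.sum_range_succ, ih, Finset.sum_range_succ]; push_cast; ring
  have hf0 : f 0 = 0 := by simp [hf]
  have h1 := htel N
  rw [Finset.range_eq_Ico, Finset.sum_eq_sum_Ico_succ_bot (by omega : 0 < N),
    Finset.sum_eq_sum_Ico_succ_bot (by omega : 0 < N), hf0] at h1
  have h2 : polygonAttraction (N + 1) = 1 / 4 * (∑ k ∈ Finset.Ico 1 N, f k + f N) := by
    rw [polygonAttraction, ← Finset.sum_Ico_succ_top (by omega : 1 ≤ N)]
  rw [h2, polygonAttraction]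
  simp only [Nat.cast_zero, mul_zero, zero_mul, zero_add, add_zero] at h1
  rw [h1] at hsum
  linarith

theorem polygonAttraction_mono {M N : ℕ} (hM : 2 ≤ M) (h : M ≤ N) :
    polygonAttraction M / (M - 1) ≤ polygonAttraction N / (N - 1) := by
  induction N, h using Nat.le_induction with
  | base => exact le_rfl
  | succ N h ih =>
    refine ih.trans ?_
    have hN : (2 : ℝ) ≤ N := by exact_mod_cast hM.trans h
    have := mul_polygonAttraction_le_succ N (by omega)
    push_cast
    rw [div_le_div_iff₀ (by linarith) (by linarith)]
    linarith

/-! ### Comparison of cosecant sums with integrals, and the threshold between 472 and 473. -/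

/-- A primitive of `1 / sin`. -/
noncomputable def logTanHalf (u : ℝ) : ℝ := Real.log (Real.sin (u / 2) / Real.cos (u / 2))

theorem sin_half_pos_cos_half_pos {u : ℝ} (h : u ∈ Set.Ioo 0 Real.pi) :
    0 < Real.sin (u / 2) ∧ 0 < Real.cos (u / 2) :=
  ⟨Real.sin_pos_of_pos_of_lt_pi (by linarith [h.1]) (by linarith [h.1, h.2]),
    Real.cos_pos_of_mem_Ioo ⟨by linarith [h.1, Real.pi_pos], by linarith [h.2]⟩⟩

theorem logTanHalf_pi_sub (u : ℝ) : logTanHalf (Real.pi - u) = -logTanHalf u := by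
  rw [logTanHalf, logTanHalf, sub_div, Real.sin_pi_div_two_sub, Real.cos_pi_div_two_sub,
    ← Real.log_inv, inv_div]

theorem logTanHalf_add_sub_logTanHalf_sub {x t : ℝ} (h1 : 0 < x - t) (h2 : x + t < Real.pi)
    (ht : 0 < t) : 0 < Real.sin t ∧ Real.sin t < Real.sin x ∧
    logTanHalf (x + t) - logTanHalf (x - t) =
      Real.log ((Real.sin x + Real.sin t) / (Real.sin x - Real.sin t)) := by
  obtain ⟨a1, a2⟩ := sin_half_pos_cos_half_pos (u := x + t) ⟨by linarith, h2⟩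
  obtain ⟨b1, b2⟩ := sin_half_pos_cos_half_pos (u := x - t) ⟨h1, by linarith⟩
  have e1 : x = (x + t) / 2 + (x - t) / 2 := by ring
  have e2 : t = (x + t) / 2 - (x - t) / 2 := by ring
  have s1 : Real.sin x + Real.sin t =
      2 * (Real.sin ((x + t) / 2) * Real.cos ((x - t) / 2)) := by
    nth_rewrite 1 [e1]; nth_rewrite 3 [e2]
    rw [Real.sin_add, Real.sin_sub]; ring
  have s2 : Real.sin x - Real.sin t =
      2 * (Real.cos ((x + t) / 2) * Real.sin ((x - t) / 2)) := by
    nth_rewrite 1 [e1]; nth_rewrite 3 [e2]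
    rw [Real.sin_add, Real.sin_sub]; ring
  refine ⟨Real.sin_pos_of_pos_of_lt_pi ht (by linarith), ?_, ?_⟩
  · have : 0 < Real.sin x - Real.sin t := by rw [s2]; positivity
    linarith
  · rw [s1, s2, logTanHalf, logTanHalf, ← Real.log_div (by positivity) (by positivity)]
    congr 1
    field_simp

/-- A midpoint rule sharpened by `sin t` in place of `t`. It reduces to `log (1 + y) ≥ 2 * y / (y +
2)` with `y = 2 * sin t / (sin x - sin t)`. -/
theorem inv_sin_le {x t : ℝ} (h1 : 0 < x - t) (h2 : x + t < Real.pi) (ht : 0 < t) :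
    1 / Real.sin x ≤ (logTanHalf (x + t) - logTanHalf (x - t)) / (2 * Real.sin t) := by
  obtain ⟨a, b, c⟩ := logTanHalf_add_sub_logTanHalf_sub h1 h2 ht
  rw [c]
  set p := Real.sin x
  set q := Real.sin t
  have hpq : 0 < p - q := by linarith
  have hp : 0 < p := by linarith
  have := Real.le_log_one_add_of_nonneg (x := 2 * q / (p - q)) (by positivity)
  have e1 : 1 + 2 * q / (p - q) = (p + q) / (p - q) := by field_simp; ring
  have e2 : 2 * (2 * q / (p - q)) / (2 * q / (p - q) + 2) = 2 * q / p := by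
    have : 2 * q / (p - q) + 2 = 2 * p / (p - q) := by field_simp; ring
    rw [this]; field_simp
  rw [e1, e2] at this
  rw [le_div_iff₀ (by positivity)]
  calc _ = 2 * q / p := by ring
    _ ≤ _ := this

/-- A trapezoidal rule sharpened by `tan t` in place of `t`. It reduces to `log z ≤ (z - z⁻¹) / 2`
for `z ≥ 1`, that is, `s ≤ sinh s` with `s = log z`. -/
theorem le_inv_sin_add_inv_sin {x t : ℝ} (h1 : 0 < x - t) (h2 : x + t < Real.pi) (ht : 0 < t)
    (ht' : t < Real.pi / 2) :
    (logTanHalf (x + t) - logTanHalf (x - t)) * (Real.cos t / Real.sin t) ≤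
      1 / Real.sin (x - t) + 1 / Real.sin (x + t) := by
  obtain ⟨a, b, c⟩ := logTanHalf_add_sub_logTanHalf_sub h1 h2 ht
  have hct := Real.cos_pos_of_mem_Ioo (x := t) ⟨by linarith, ht'⟩
  have hs1 := Real.sin_pos_of_pos_of_lt_pi h1 (by linarith)
  have hs2 := Real.sin_pos_of_pos_of_lt_pi (x := x + t) (by linarith) h2
  have e : 1 / Real.sin (x - t) + 1 / Real.sin (x + t) =
      2 * Real.sin x * Real.cos t / (Real.sin x ^ 2 - Real.sin t ^ 2) := by
    have e1 : Real.sin (x - t) * Real.sin (x + t) = Real.sin x ^ 2 - Real.sin t ^ 2 := by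
      rw [Real.sin_sub, Real.sin_add]
      linear_combination Real.sin x ^ 2 * Real.sin_sq_add_cos_sq t -
        Real.sin t ^ 2 * Real.sin_sq_add_cos_sq x
    rw [← e1, div_add_div _ _ hs1.ne' hs2.ne', Real.sin_sub, Real.sin_add]
    congr 1; ring
  rw [c, e]
  set p := Real.sin x
  set q := Real.sin t
  have hpq : 0 < p - q := by linarith
  have hp : 0 < p := by linarith
  set z := (p + q) / (p - q) with hz
  have hz1 : 1 ≤ z := by rw [hz, le_div_iff₀ hpq]; linarith
  have hz0 : 0 < z := by linarith
  have hlog : Real.log z ≤ (z - z⁻¹) / 2 := by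
    have := Real.self_le_sinh_iff.2 (Real.log_nonneg hz1)
    rwa [Real.sinh_eq, Real.exp_neg, Real.exp_log hz0] at this
  have e3 : (z - z⁻¹) / 2 = 2 * p * q / (p ^ 2 - q ^ 2) := by
    have h3 : p ^ 2 - q ^ 2 ≠ 0 := by
      have : p ^ 2 - q ^ 2 = (p - q) * (p + q) := by ring
      rw [this]; positivity
    rw [hz, inv_div]
    field_simp
    ring
  rw [e3] at hlog
  calc _ ≤ (2 * p * q / (p ^ 2 - q ^ 2)) * (Real.cos t / q) :=
        mul_le_mul_of_nonneg_right hlog (by positivity)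
    _ = _ := by field_simp

/-- The terms near the two poles, equal by `l ↦ N - l`, are to be estimated one by one; only the
middle block is compared with an integral. -/
theorem sum_inv_sin_split {N K : ℕ} (hK : 1 ≤ K) (h : 2 * K ≤ N) :
    ∑ l ∈ Finset.Ico 1 N, 1 / Real.sin (Real.pi * l / N) =
      2 * ∑ l ∈ Finset.Ico 1 K, 1 / Real.sin (Real.pi * l / N) +
        ∑ l ∈ Finset.Ico K (N + 1 - K), 1 / Real.sin (Real.pi * l / N) := by
  have hN : (0 : ℝ) < N := by exact_mod_cast (by omega : 0 < N)
  have h1 := Finset.sum_Ico_reflect (fun l : ℕ => 1 / Real.sin (Real.pi * l / N)) 1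
    (by omega : K ≤ N + 1)
  rw [Nat.add_sub_cancel] at h1
  rw [← Finset.sum_Ico_consecutive _ (by omega : 1 ≤ N + 1 - K) (by omega : N + 1 - K ≤ N),
    ← Finset.sum_Ico_consecutive _ (by omega : 1 ≤ K) (by omega : K ≤ N + 1 - K), ← h1]
  have h2 : ∀ l ∈ Finset.Ico 1 K, 1 / Real.sin (Real.pi * (N - l : ℕ) / N) =
      1 / Real.sin (Real.pi * l / N) := by
    intro l hl
    have hl' := Finset.mem_Ico.1 hl
    rw [Nat.cast_sub (by omega), ← Real.sin_pi_sub]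
    congr 2
    field_simp
    ring
  rw [Finset.sum_congr rfl h2]
  ring

/-- The midpoint bounds telescope between the half-integers `K - 1 / 2` and `N - K + 1 / 2`, where
the primitive takes opposite values. -/
theorem sum_inv_sin_le {N K : ℕ} (hK : 1 ≤ K) (h : 2 * K ≤ N) :
    ∑ l ∈ Finset.Ico K (N + 1 - K), 1 / Real.sin (Real.pi * l / N) ≤
      -logTanHalf (Real.pi * (2 * K - 1) / (2 * N)) / Real.sin (Real.pi / (2 * N)) := by
  have hN : (0 : ℝ) < N := by exact_mod_cast (by omega : 0 < N)
  have hK' : (1 : ℝ) ≤ K := by exact_mod_cast hK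
  set F : ℕ → ℝ := fun l => logTanHalf (Real.pi * (2 * l - 1) / (2 * N)) with hF
  have ht : 0 < Real.pi / (2 * N) := by have := Real.pi_pos; positivity
  have key : ∀ M, K ≤ M → M ≤ N → ∑ l ∈ Finset.Ico K M, 1 / Real.sin (Real.pi * l / N) ≤
      (F M - F K) / (2 * Real.sin (Real.pi / (2 * N))) := by
    intro M hM
    induction M, hM using Nat.le_induction with
    | base => simp
    | succ M hM ih =>
      intro hMN
      have hM' : (K : ℝ) ≤ M := by exact_mod_cast hM
      have hMN' : (M : ℝ) + 1 ≤ N := by exact_mod_cast hMN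
      rw [Finset.sum_Ico_succ_top hM]
      have hx : Real.pi / (2 * N) < Real.pi * M / N := by
        rw [div_lt_div_iff₀ (by positivity) hN]
        have : 0 < Real.pi * N := by have := Real.pi_pos; positivity
        nlinarith
      have hx' : Real.pi * M / N + Real.pi / (2 * N) < Real.pi := by
        rw [div_add_div _ _ hN.ne' (by positivity), div_lt_iff₀ (by positivity)]
        have : 0 < Real.pi * N := by have := Real.pi_pos; positivity
        nlinarith
      have h3 := inv_sin_le (sub_pos.2 hx) hx' ht
      have e1 : logTanHalf (Real.pi * M / N + Real.pi / (2 * N)) = F (M + 1) := by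
        simp only [hF]; congr 1; push_cast; field_simp; ring
      have e2 : logTanHalf (Real.pi * M / N - Real.pi / (2 * N)) = F M := by
        simp only [hF]; congr 1; field_simp
      rw [e1, e2] at h3
      refine (add_le_add (ih (by omega)) h3).trans_eq ?_
      rw [← add_div]; congr 1; ring
  refine (key (N + 1 - K) (by omega) (by omega)).trans_eq ?_
  have e : F (N + 1 - K) = -F K := by
    simp only [hF]
    rw [← logTanHalf_pi_sub, Nat.cast_sub (by omega)]
    congr 1; push_cast; field_simp; ring
  rw [e, ← neg_add', ← two_mul, neg_div, mul_div_mul_left _ _ two_ne_zero, neg_div]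

theorem le_sum_inv_sin {N K : ℕ} (hK : 1 ≤ K) (h : 2 * K ≤ N) :
    1 / Real.sin (Real.pi * K / N) - logTanHalf (Real.pi * K / N) *
      (Real.cos (Real.pi / (2 * N)) / Real.sin (Real.pi / (2 * N))) ≤
      ∑ l ∈ Finset.Ico K (N + 1 - K), 1 / Real.sin (Real.pi * l / N) := by
  have hN : (0 : ℝ) < N := by exact_mod_cast (by omega : 0 < N)
  have hK' : (1 : ℝ) ≤ K := by exact_mod_cast hK
  have hKN : 2 * (K : ℝ) ≤ N := by exact_mod_cast h
  set F : ℕ → ℝ := fun l => logTanHalf (Real.pi * l / N) with hF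
  set c := Real.cos (Real.pi / (2 * N)) / Real.sin (Real.pi / (2 * N))
  have ht : 0 < Real.pi / (2 * N) := by have := Real.pi_pos; positivity
  have ht' : Real.pi / (2 * N) < Real.pi / 2 := by
    apply div_lt_div_of_pos_left Real.pi_pos (by norm_num); linarith
  have key : ∀ M, K ≤ M → M < N → (F M - F K) * c + 1 / Real.sin (Real.pi * K / N) +
      1 / Real.sin (Real.pi * M / N) ≤
      2 * ∑ l ∈ Finset.Ico K (M + 1), 1 / Real.sin (Real.pi * l / N) := by
    intro M hM
    induction M, hM using Nat.le_induction with
    | base => intro _; simp; linarith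
    | succ M hM ih =>
      intro hMN
      have hM' : (K : ℝ) ≤ M := by exact_mod_cast hM
      have hMN' : (M : ℝ) + 1 + 1 ≤ N := by exact_mod_cast hMN
      rw [Finset.sum_Ico_succ_top (by omega)]
      have e1 : Real.pi * (2 * M + 1) / (2 * N) + Real.pi / (2 * N) =
          Real.pi * (M + 1 : ℕ) / N := by
        push_cast; field_simp; ring
      have e2 : Real.pi * (2 * M + 1) / (2 * N) - Real.pi / (2 * N) = Real.pi * M / N := by
        field_simp; ring
      have h3 := le_inv_sin_add_inv_sin (x := Real.pi * (2 * M + 1) / (2 * N))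
        (t := Real.pi / (2 * N))
        (by rw [e2]; have := Real.pi_pos; have : (0 : ℝ) < M := by linarith
            positivity)
        (by rw [e1, div_lt_iff₀ hN]; push_cast; nlinarith [Real.pi_pos]) ht ht'
      rw [e1, e2] at h3
      have := ih (by omega)
      simp only [hF] at this ⊢
      linarith
  have := key (N - K) (by omega) (by omega)
  have e : F (N - K) = -F K := by
    simp only [hF]
    rw [← logTanHalf_pi_sub, Nat.cast_sub (by omega)]
    congr 1; field_simp
  have e' : Real.sin (Real.pi * (N - K : ℕ) / N) = Real.sin (Real.pi * K / N) := by
    rw [← Real.sin_pi_sub, Nat.cast_sub (by omega)]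
    congr 1; field_simp; ring
  rw [e, e', show N - K + 1 = N + 1 - K by omega] at this
  simp only [hF] at this
  linarith

theorem inv_sin_le_of_le_one {x : ℝ} (h0 : 0 < x) (h1 : x ≤ 1) :
    1 / Real.sin x ≤ 1 / x + x / 6 + x ^ 3 / 30 := by
  have h2 := Real.sin_gt_sub_cube h0
  have hs : 0 < x - x ^ 3 / 6 := by nlinarith [mul_pos h0 h0, pow_pos h0 3]
  refine (one_div_le_one_div_of_le hs h2.le).trans ?_
  rw [div_le_iff₀ hs]
  have e : (1 / x + x / 6 + x ^ 3 / 30) * (x - x ^ 3 / 6) = 1 + x ^ 4 * (1 - x ^ 2) / 180 := by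
    field_simp; ring
  rw [e]
  have : 0 ≤ x ^ 4 * (1 - x ^ 2) := mul_nonneg (by positivity) (by nlinarith)
  linarith

theorem polygonAttraction_472_lt : polygonAttraction 472 < 472 := by
  have p1 := Real.pi_gt_d6
  have p2 := Real.pi_lt_d6
  have h1 : ∑ l ∈ Finset.Ico (1 : ℕ) 10, 1 / Real.sin (Real.pi * l / (472 : ℕ)) ≤
      ∑ l ∈ Finset.Ico (1 : ℕ) 10, (472 / (3.141592 * (l : ℝ)) + 3.141593 * l / 2832 +
        (3.141593 * l / 472) ^ 3 / 30) := by
    refine Finset.sum_le_sum fun l hl => ?_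
    have hl' := Finset.mem_Ico.1 hl
    have l1 : (1 : ℝ) ≤ l := by exact_mod_cast hl'.1
    have l2 : (l : ℝ) ≤ 9 := by exact_mod_cast Nat.le_of_lt_succ hl'.2
    have hx : 0 < Real.pi * l / 472 := by positivity
    have hx1 : Real.pi * l / 472 ≤ 1 := by rw [div_le_one (by norm_num)]; nlinarith
    push_cast
    refine (inv_sin_le_of_le_one hx hx1).trans ?_
    have b1 : 1 / (Real.pi * l / 472) ≤ 472 / (3.141592 * (l : ℝ)) := by
      rw [one_div_div]
      exact div_le_div_of_nonneg_left (by norm_num) (by positivity) (by gcongr)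
    have b2 : Real.pi * l / 472 ≤ 3.141593 * l / 472 := by gcongr
    have b3 : (Real.pi * l / 472) ^ 3 ≤ (3.141593 * l / 472) ^ 3 :=
      pow_le_pow_left₀ hx.le b2 3
    linarith
  have h2 := sum_inv_sin_le (N := 472) (K := 10) (by norm_num) (by norm_num)
  have h3 := sum_inv_sin_split (N := 472) (K := 10) (by norm_num) (by norm_num)
  have hy : 0.031615 < Real.pi * 19 / 1888 ∧ Real.pi * 19 / 1888 < 0.031616 := by
    constructor <;> linarith
  have hlog : -logTanHalf (Real.pi * (2 * (10 : ℕ) - 1) / (2 * (472 : ℕ))) ≤ 3.45378 := by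
    have e : Real.pi * (2 * (10 : ℕ) - 1) / (2 * (472 : ℕ)) / 2 = Real.pi * 19 / 1888 := by
      push_cast; ring
    rw [logTanHalf, e]
    have a1 := Real.sin_gt_sub_cube (x := Real.pi * 19 / 1888) (by linarith [hy.1])
    have a2 := (abs_le.1 (Real.cos_bound (x := Real.pi * 19 / 1888)
      (by rw [abs_of_pos (by linarith [hy.1])]; linarith [hy.2]))).2
    rw [abs_of_pos (by linarith [hy.1] : 0 < Real.pi * 19 / 1888)] at a2
    set y := Real.pi * 19 / 1888 with hyd
    have y1 : 0.03161557 < y := by rw [hyd]; linarith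
    have b1 : 0.0316103 < Real.sin y := by
      have : y ^ 3 ≤ 0.031616 ^ 3 := pow_le_pow_left₀ (by linarith) hy.2.le 3
      norm_num at this ⊢; linarith
    have b2 : Real.cos y < 0.9995004 := by
      have : y ^ 4 ≤ 0.031616 ^ 4 := pow_le_pow_left₀ (by linarith) hy.2.le 4
      have : (0.0316155 : ℝ) ^ 2 ≤ y ^ 2 := pow_le_pow_left₀ (by norm_num) (by linarith) 2
      norm_num at *; linarith
    have b3 : 0 < Real.cos y := Real.cos_pos_of_mem_Ioo ⟨by linarith, by linarith⟩
    rw [← Real.log_inv, inv_div]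
    -- A power of two is split off so that the logarithm follows from the decimals of `log 2` and a
    -- rational bound for `log (1 + x)` with small `x`.
    have c1 : Real.cos y / Real.sin y ≤ 2 ^ 5 / (1 + 0.01203) := by
      rw [div_le_div_iff₀ (by linarith) (by norm_num)]; linarith
    refine (Real.log_le_log (by apply div_pos b3; linarith) c1).trans ?_
    rw [Real.log_div (by norm_num) (by norm_num), Real.log_pow]
    have c2 := Real.le_log_one_add_of_nonneg (x := 0.01203) (by norm_num)
    have c3 := Real.log_two_lt_d9
    norm_num at c2 ⊢
    linarith
  have hsin : 0.00332795 < Real.sin (Real.pi / (2 * (472 : ℕ))) := by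
    have ht : 0.0033279576 < Real.pi / (2 * (472 : ℕ)) ∧
        Real.pi / (2 * (472 : ℕ)) < 0.003328 := by
      push_cast; constructor <;> linarith
    have a1 := Real.sin_gt_sub_cube (x := Real.pi / (2 * (472 : ℕ))) (by linarith [ht.1])
    have := pow_le_pow_left₀ (by linarith [ht.1]) ht.2.le 3
    norm_num at *; linarith
  have h4 : -logTanHalf (Real.pi * (2 * (10 : ℕ) - 1) / (2 * (472 : ℕ))) /
      Real.sin (Real.pi / (2 * (472 : ℕ))) ≤ 3.45378 / 0.00332795 :=
    div_le_div₀ (by norm_num) hlog (by norm_num) hsin.le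
  rw [polygonAttraction, h3]
  clear h3
  generalize ∑ l ∈ Finset.Ico (10 : ℕ) (472 + 1 - 10), 1 / Real.sin (Real.pi * l / (472 : ℕ)) = T at h2 ⊢
  norm_num [Finset.sum_Ico_succ_top] at h1 h2 h4 ⊢
  linarith

theorem lt_polygonAttraction_473 : 473 < polygonAttraction 473 := by
  have p1 := Real.pi_gt_d6
  have p2 := Real.pi_lt_d6
  have h0 : ∀ l ∈ Finset.Ico (1 : ℕ) 10, 473 / (3.141593 * (l : ℝ)) ≤
      1 / Real.sin (Real.pi * l / (473 : ℕ)) := by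
    intro l hl
    have hl' := Finset.mem_Ico.1 hl
    have l1 : (1 : ℝ) ≤ l := by exact_mod_cast hl'.1
    have hx : 0 < Real.pi * l / 473 := by positivity
    have hs := sin_pi_mul_div_pos (N := 473) (l := l) hl'.1 (by omega)
    push_cast at hs ⊢
    calc _ ≤ 473 / (Real.pi * l) := by gcongr
      _ = 1 / (Real.pi * l / 473) := by rw [one_div_div]
      _ ≤ _ := one_div_le_one_div_of_le hs (Real.sin_le hx.le)
  have h1 : ∑ l ∈ Finset.Ico (1 : ℕ) 9, 473 / (3.141593 * (l : ℝ)) ≤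
      ∑ l ∈ Finset.Ico (1 : ℕ) 9, 1 / Real.sin (Real.pi * l / (473 : ℕ)) :=
    Finset.sum_le_sum fun l hl => h0 l (Finset.Ico_subset_Ico_right (by norm_num) hl)
  have h1' := h0 9 (by simp)
  have h2 := le_sum_inv_sin (N := 473) (K := 9) (by norm_num) (by norm_num)
  have h3 := sum_inv_sin_split (N := 473) (K := 9) (by norm_num) (by norm_num)
  have hy : 0.029888 < Real.pi * 9 / 946 ∧ Real.pi * 9 / 946 < 0.0298885 := by
    constructor <;> linarith
  have hlog : 3.50997 ≤ -logTanHalf (Real.pi * (9 : ℕ) / (473 : ℕ)) := by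
    have e : Real.pi * (9 : ℕ) / (473 : ℕ) / 2 = Real.pi * 9 / 946 := by
      push_cast; ring
    rw [logTanHalf, e]
    have a1 := (abs_le.1 (Real.sin_bound (x := Real.pi * 9 / 946)
      (by rw [abs_of_pos (by linarith [hy.1])]; linarith [hy.2]))).2
    rw [abs_of_pos (by linarith [hy.1] : 0 < Real.pi * 9 / 946)] at a1
    have a2 := Real.one_sub_sq_div_two_le_cos (x := Real.pi * 9 / 946)
    set y := Real.pi * 9 / 946 with hyd
    have b0 : 0 < Real.sin y := Real.sin_pos_of_pos_of_lt_pi (by linarith) (by linarith)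
    have y1 : y < 0.02988831 := by rw [hyd]; linarith
    have b1 : Real.sin y < 0.0298840 := by
      have : y ^ 5 ≤ 0.0298885 ^ 5 := pow_le_pow_left₀ (by linarith) hy.2.le 5
      have : (0.029888 : ℝ) ^ 3 ≤ y ^ 3 := pow_le_pow_left₀ (by norm_num) hy.1.le 3
      norm_num at *; linarith
    have b2 : 0.9995533 < Real.cos y := by
      have : y ^ 2 ≤ 0.0298885 ^ 2 := pow_le_pow_left₀ (by linarith) hy.2.le 2
      norm_num at *; linarith
    rw [← Real.log_inv, inv_div]
    have c1 : 2 ^ 5 * (1 + 0.04524) ≤ Real.cos y / Real.sin y := by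
      rw [le_div_iff₀ b0]; linarith
    refine le_trans ?_ (Real.log_le_log (by norm_num) c1)
    rw [Real.log_mul (by norm_num) (by norm_num), Real.log_pow]
    have c2 := Real.le_log_one_add_of_nonneg (x := 0.04524) (by norm_num)
    have c3 := Real.log_two_gt_d9
    norm_num at c2 ⊢
    linarith
  have hcot : 301.119 ≤ Real.cos (Real.pi / (2 * (473 : ℕ))) /
      Real.sin (Real.pi / (2 * (473 : ℕ))) := by
    have ht : 0.0033209 < Real.pi / (2 * (473 : ℕ)) ∧
        Real.pi / (2 * (473 : ℕ)) < 0.003320923 := by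
      push_cast; constructor <;> linarith
    have a1 := Real.sin_le (x := Real.pi / (2 * (473 : ℕ))) (by linarith [ht.1])
    have a2 := Real.one_sub_sq_div_two_le_cos (x := Real.pi / (2 * (473 : ℕ)))
    have a3 : 0 < Real.sin (Real.pi / (2 * (473 : ℕ))) :=
      Real.sin_pos_of_pos_of_lt_pi (by linarith [ht.1]) (by linarith [ht.2])
    have := pow_le_pow_left₀ (by linarith [ht.1]) ht.2.le 2
    rw [le_div_iff₀ a3]
    norm_num at *; linarith
  have h4 : 3.50997 * 301.119 ≤ -logTanHalf (Real.pi * (9 : ℕ) / (473 : ℕ)) *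
      (Real.cos (Real.pi / (2 * (473 : ℕ))) / Real.sin (Real.pi / (2 * (473 : ℕ)))) :=
    mul_le_mul hlog hcot (by norm_num) (by linarith)
  rw [polygonAttraction, h3]
  clear h3
  generalize ∑ l ∈ Finset.Ico (9 : ℕ) (473 + 1 - 9), 1 / Real.sin (Real.pi * l / (473 : ℕ)) = T at h2 ⊢
  norm_num [Finset.sum_Ico_succ_top] at h1 h1' h2 h4 ⊢
  linarith

/-- Monotonicity gives `Γ_N < 472 * (N - 1) / 471`, and this is at most `N` exactly when `N ≤ 472`.
The next lemma uses `473 * (N - 1) / 472 ≥ N` for `N ≥ 473` in the same way. -/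
theorem polygonAttraction_lt {N : ℕ} (h2 : 2 ≤ N) (h : N ≤ 472) : polygonAttraction N < N := by
  have := polygonAttraction_mono h2 h
  have h3 := polygonAttraction_472_lt
  have h2' : (2 : ℝ) ≤ N := by exact_mod_cast h2
  have h' : (N : ℝ) ≤ 472 := by exact_mod_cast h
  rw [div_le_div_iff₀ (by linarith) (by norm_num)] at this
  push_cast at this
  nlinarith

theorem lt_polygonAttraction {N : ℕ} (h : 473 ≤ N) : N < polygonAttraction N := by
  have := polygonAttraction_mono (by norm_num) h
  have h3 := lt_polygonAttraction_473
  have h' : (473 : ℝ) ≤ N := by exact_mod_cast h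
  rw [div_le_div_iff₀ (by norm_num) (by linarith)] at this
  push_cast at this
  nlinarith

/-! ### Newton's equations as convolutions on `ZMod N`. -/

theorem attraction_div {x y : ℂ} (hy : y ≠ 0) (w : ℝ) :
    (w / ‖x - y‖ ^ 3) • (x - y) = y / (‖y‖ : ℂ) ^ 3 * (w * attraction (x / y)) := by
  have h1 : x / y - 1 = (x - y) / y := by field_simp
  have h2 : (‖y‖ : ℂ) ≠ 0 := by simpa using hy
  rw [attraction, h1, norm_div, Complex.real_smul]
  by_cases h : x - y = 0
  · simp [h]
  have h3 : (‖x - y‖ : ℂ) ≠ 0 := by simpa using h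
  push_cast
  field_simp

theorem sum_attraction {ι : Type} [Fintype ι] [DecidableEq ι] (w : ι → ℝ) (x : ι → ℂ) (i : ι)
    (hi : x i ≠ 0) :
    ∑ j ∈ Finset.univ.erase i, (w j / ‖x j - x i‖ ^ 3) • (x j - x i) =
      x i / (‖x i‖ : ℂ) ^ 3 * ∑ j, w j * attraction (x j / x i) := by
  -- Division by zero gives `attraction 1 = 0`, so the body itself may be included in the sum.
  rw [Finset.mul_sum, ← Finset.add_sum_erase _ _ (Finset.mem_univ i), div_self hi, attraction_one]
  simp only [mul_zero, zero_add]
  exact Finset.sum_congr rfl fun j _ => attraction_div hi _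

theorem IsUniformRotation.apply_zero {ι : Type} {x : ι → ℂ} {X : ℝ → ι → ℂ}
    (h : IsUniformRotation x X) : X 0 = x := by
  obtain ⟨ω, h⟩ := h
  funext i
  rw [h]; simp

/-- The difference of two systems of masses exerts no force. -/
theorem sum_sub_attraction_eq_zero {ι : Type} [Fintype ι] [DecidableEq ι] {m m' : ι → ℝ}
    {X : ℝ → ι → ℂ} (h : IsNBodySolution m X) (h' : IsNBodySolution m' X) (i : ι)
    (hi : X 0 i ≠ 0) : ∑ j, ((m' j - m j : ℝ) : ℂ) * attraction (X 0 j / X 0 i) = 0 := by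
  obtain ⟨_, V, hV⟩ := h
  obtain ⟨_, V', hV'⟩ := h'
  have hVV : V = V' := by
    funext t i
    exact (hV t i).1.unique (hV' t i).1
  subst hVV
  have h1 := (hV 0 i).2.unique (hV' 0 i).2
  rw [sum_attraction _ _ _ hi, sum_attraction _ _ _ hi] at h1
  have h2 : X 0 i / (‖X 0 i‖ : ℂ) ^ 3 ≠ 0 := by
    have : (‖X 0 i‖ : ℂ) ≠ 0 := by simpa using hi
    positivity
  have h3 := mul_left_cancel₀ h2 h1
  rw [← sub_eq_zero, ← Finset.sum_sub_distrib] at h3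
  rw [← neg_eq_zero, ← Finset.sum_neg_distrib, ← h3]
  refine Finset.sum_congr rfl fun j _ => ?_
  push_cast; ring

section Transform

variable {N : ℕ}

/-- The masses `w` placed at the points `p` of `ZMod N`. -/
def massAt {ι : Type} [Fintype ι] (p : ι → ZMod N) (w : ι → ℝ) (j : ZMod N) : ℂ :=
  ∑ l, if p l = j then (w l : ℂ) else 0

theorem massAt_conj {ι : Type} [Fintype ι] (p : ι → ZMod N) (w : ι → ℝ) (j : ZMod N) :
    (starRingEnd ℂ) (massAt p w j) = massAt p w j := by
  rw [massAt, map_sum]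
  refine Finset.sum_congr rfl fun l _ => ?_
  split_ifs <;> simp

theorem massAt_apply {ι : Type} [Fintype ι] {p : ι → ZMod N} (hp : Function.Injective p)
    (w : ι → ℝ) (l : ι) : massAt p w (p l) = w l := by
  classical
  rw [massAt, Finset.sum_eq_single l (fun l' _ h => if_neg (fun e => h (hp e))) (by simp)]
  simp

variable [NeZero N]

/-- The convolution theorem: `attractionDFT N ρ m` is the eigenvalue on mode `m` of the force of one
polygon on the vertices of another. -/
theorem dft_sum_attraction (α : ZMod N → ℂ) (ρ : ℝ) (m : ZMod N) :
    ∑ i, ZMod.stdAddChar (-(i * m)) * ∑ j, α j * attraction (ρ * ZMod.stdAddChar (j - i)) =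
      ZMod.dft α m * attractionDFT N ρ m := by
  simp_rw [Finset.mul_sum]
  rw [Finset.sum_comm, ZMod.dft_apply, Finset.sum_mul]
  refine Finset.sum_congr rfl fun j _ => ?_
  rw [attractionDFT, Finset.mul_sum, ← Equiv.sum_comp (Equiv.subLeft j)]
  refine Finset.sum_congr rfl fun d _ => ?_
  simp only [Equiv.subLeft_apply, sub_sub_cancel, smul_eq_mul]
  have : -((j - d) * m) = -(j * m) + m * d := by ring
  rw [this, AddChar.map_add_eq_mul]; ring

theorem sum_stdAddChar_mul_attraction (ρ : ℝ) (k i : ZMod N) :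
    ∑ j, ZMod.stdAddChar (k * j) * attraction (ρ * ZMod.stdAddChar (j - i)) =
      ZMod.stdAddChar (k * i) * attractionDFT N ρ k := by
  rw [attractionDFT, Finset.mul_sum, ← Equiv.sum_comp (Equiv.addRight i)]
  refine Finset.sum_congr rfl fun d _ => ?_
  simp only [Equiv.coe_addRight, add_sub_cancel_right, mul_add, AddChar.map_add_eq_mul]
  ring

theorem eq_sum_dft (α : ZMod N → ℂ) (j : ZMod N) :
    α j = (N : ℂ)⁻¹ * ∑ k, ZMod.stdAddChar (k * j) * ZMod.dft α k := by
  have := ZMod.invDFT_apply (ZMod.dft α) j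
  simpa using this

theorem sum_attraction_eq_sum_dft (α : ZMod N → ℂ) (ρ : ℝ) (i : ZMod N) :
    N * ∑ j, α j * attraction (ρ * ZMod.stdAddChar (j - i)) =
      ∑ k, ZMod.stdAddChar (k * i) * ZMod.dft α k * attractionDFT N ρ k := by
  have hN : (N : ℂ) ≠ 0 := by exact_mod_cast NeZero.ne N
  have h1 : ∀ j, α j * attraction (ρ * ZMod.stdAddChar (j - i)) = (N : ℂ)⁻¹ *
      ∑ k, ZMod.dft α k * (ZMod.stdAddChar (k * j) * attraction (ρ * ZMod.stdAddChar (j - i))) := by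
    intro j
    rw [eq_sum_dft α j, Finset.mul_sum, Finset.mul_sum, Finset.sum_mul]
    refine Finset.sum_congr rfl fun k _ => ?_
    ring
  simp_rw [h1]
  rw [← Finset.mul_sum, mul_inv_cancel_left₀ hN, Finset.sum_comm]
  refine Finset.sum_congr rfl fun k _ => ?_
  rw [← Finset.mul_sum, sum_stdAddChar_mul_attraction]; ring

theorem dft_neg_eq_conj {α : ZMod N → ℂ} (hα : ∀ j, (starRingEnd ℂ) (α j) = α j) (m : ZMod N) :
    ZMod.dft α (-m) = (starRingEnd ℂ) (ZMod.dft α m) := by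
  rw [ZMod.dft_apply, ZMod.dft_apply, map_sum]
  refine Finset.sum_congr rfl fun j _ => ?_
  rw [smul_eq_mul, smul_eq_mul, map_mul, hα, ← AddChar.map_neg_eq_conj]
  congr 2; ring

theorem sum_massAt {ι : Type} [Fintype ι] (p : ι → ZMod N) (w : ι → ℝ) (f : ZMod N → ℂ) :
    ∑ j, massAt p w j * f j = ∑ l, w l * f (p l) := by
  simp_rw [massAt, Finset.sum_mul]
  rw [Finset.sum_comm]
  refine Finset.sum_congr rfl fun l _ => ?_
  simp

end Transform

/-! ### Nonexistence for `n ≤ 236`. -/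

theorem attractionDFT_one_mul_neg (n : ℕ) [NeZero (2 * n)] {m : ZMod (2 * n)} (h0 : m ≠ 0)
    (hn : m ≠ n) : (attractionDFT (2 * n) 1 m).re * (attractionDFT (2 * n) 1 (-m)).re < 0 := by
  wlog h : m.val < n generalizing m
  · have h1 := m.val_lt
    have h2 : m.val ≠ n := fun e => hn (by simpa using congrArg (Nat.cast : ℕ → ZMod (2 * n)) e)
    have h3 : (-m).val = 2 * n - m.val := by rw [ZMod.neg_val, if_neg h0]
    have := this (m := -m) (neg_ne_zero.2 h0) (fun e => hn ?_) (by omega)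
    · rwa [neg_neg, mul_comm] at this
    · have h4 : ((2 * n : ℕ) : ZMod (2 * n)) = 0 := ZMod.natCast_self _
      push_cast at h4
      linear_combination -e - h4
  · have h3 : (-m).val = 2 * n - m.val := by rw [ZMod.neg_val, if_neg h0]
    have h1 := attractionDFT_one_re_neg n m.val h
    have h4 : m.val ≠ 0 := by simpa using h0
    have h2 := attractionDFT_one_re_pos n (-m).val (by omega) (ZMod.val_lt _)
    simp only [ZMod.natCast_val, ZMod.cast_id', id_eq] at h1 h2
    exact mul_neg_of_neg_of_pos h1 h2

theorem attractionDFT_re_mul_pos (N : ℕ) [NeZero N] {ρ σ : ℝ} (hρ : 0 < ρ) (h1 : ρ ≠ 1)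
    (hσ : 0 < σ) (h2 : 0 < (ρ - 1) * (σ - 1)) (k l : ZMod N) :
    0 < (attractionDFT N ρ k).re * (attractionDFT N σ l).re := by
  rcases lt_or_gt_of_ne h1 with h | h
  · have : σ < 1 := by nlinarith
    exact mul_pos_of_neg_of_neg (attractionDFT_re_neg N hρ h _) (attractionDFT_re_neg N hσ this _)
  · have : 1 < σ := by nlinarith
    exact mul_pos (attractionDFT_re_pos N h _) (attractionDFT_re_pos N this _)

/-- One of `ρ`, `ρ⁻¹` is below `1` and the other above. The second product needs the stronger bound
by `-N` for mode `0` on the side below `1`. -/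
theorem attractionDFT_re_mul_inv_neg (N : ℕ) [NeZero N] {ρ : ℝ} (hρ : 0 < ρ) (h1 : ρ ≠ 1)
    (k l : ZMod N) : (attractionDFT N ρ k).re * (attractionDFT N ρ⁻¹ l).re < 0 ∧
      (N + (attractionDFT N ρ 0).re) * (N + (attractionDFT N ρ⁻¹ 0).re) < 0 := by
  have hN : (0 : ℝ) < N := by exact_mod_cast NeZero.pos N
  rcases lt_or_gt_of_ne h1 with h | h
  · have h' := (one_lt_inv₀ hρ).2 h
    refine ⟨mul_neg_of_neg_of_pos (attractionDFT_re_neg N hρ h _) (attractionDFT_re_pos N h' _),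
      mul_neg_of_neg_of_pos ?_ ?_⟩
    · linarith [attractionDFT_zero_re_lt N hρ h]
    · linarith [attractionDFT_re_pos N h' 0]
  · have h' := inv_lt_one_of_one_lt₀ h
    have h0 := inv_pos.2 hρ
    refine ⟨mul_neg_of_pos_of_neg (attractionDFT_re_pos N h _) (attractionDFT_re_neg N h0 h' _),
      mul_neg_of_pos_of_neg ?_ ?_⟩
    · linarith [attractionDFT_re_pos N h 0]
    · linarith [attractionDFT_zero_re_lt N h0 h']

theorem modes_eq_zero (n : ℕ) [NeZero (2 * n)] {ρ : ℝ} (hρ : 0 < ρ) (h1 : ρ ≠ 1)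
    {α β : ZMod (2 * n) → ℂ} (hα : ∀ j, (starRingEnd ℂ) (α j) = α j)
    (hβ : ∀ j, (starRingEnd ℂ) (β j) = β j) {m : ZMod (2 * n)} (h0 : m ≠ 0) (hn : m ≠ n)
    (h : ∀ k, k ≠ 0 → ZMod.dft α k * attractionDFT (2 * n) ρ k +
      ZMod.dft β k * attractionDFT (2 * n) 1 k = 0) :
    -- As `α`, `β` are real, the conjugate of the equation at `-m` is a second equation for the same
    -- two unknowns. In the determinant `a * b' - a' * b`, the numbers `a, a'` have the same sign
    -- and `b, b'` opposite signs.
    ZMod.dft α m = 0 ∧ ZMod.dft β m = 0 := by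
  have e1 := h m h0
  have e2 := congrArg (starRingEnd ℂ) (h (-m) (neg_ne_zero.2 h0))
  rw [dft_neg_eq_conj hα, dft_neg_eq_conj hβ] at e2
  simp only [map_add, map_mul, Complex.conj_conj, attractionDFT_conj, map_zero] at e2
  have p1 := attractionDFT_re_mul_pos (2 * n) hρ h1 hρ (mul_self_pos.2 (sub_ne_zero.2 h1)) m (-m)
  have p2 := attractionDFT_one_mul_neg n h0 hn
  rw [attractionDFT_eq_re _ ρ, attractionDFT_eq_re _ 1] at e1 e2
  set a := (attractionDFT (2 * n) ρ m).re
  set a' := (attractionDFT (2 * n) ρ (-m)).re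
  set b := (attractionDFT (2 * n) 1 m).re
  set b' := (attractionDFT (2 * n) 1 (-m)).re
  have hdet : a * b' - a' * b ≠ 0 := by
    intro h
    have h3 : (a * a') * (b * b') < 0 := mul_neg_of_pos_of_neg p1 p2
    have h4 : a * b' = a' * b := by linarith
    have h5 : (a * a') * (b * b') = (a' * b) ^ 2 := by linear_combination (a' * b) * h4
    nlinarith [sq_nonneg (a' * b)]
  have hdet' : (a * b' - a' * b : ℂ) ≠ 0 := by exact_mod_cast hdet
  constructor
  · apply (mul_eq_zero.1 (?_ : (a * b' - a' * b : ℂ) * ZMod.dft α m = 0)).resolve_left hdet'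
    linear_combination (b' : ℂ) * e1 - (b : ℂ) * e2
  · apply (mul_eq_zero.1 (?_ : (a * b' - a' * b : ℂ) * ZMod.dft β m = 0)).resolve_left hdet'
    linear_combination (a : ℂ) * e2 - (a' : ℂ) * e1

theorem stdAddChar_half_sq (n : ℕ) [NeZero (2 * n)] (i : ZMod (2 * n)) :
    (ZMod.stdAddChar ((n : ZMod (2 * n)) * i) : ℂ) * ZMod.stdAddChar ((n : ZMod (2 * n)) * i) = 1 := by
  rw [← AddChar.map_add_eq_mul]
  have h4 : ((2 * n : ℕ) : ZMod (2 * n)) = 0 := ZMod.natCast_self _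
  push_cast at h4
  have : (n : ZMod (2 * n)) * i + n * i = 0 := by linear_combination i * h4
  rw [this, AddChar.map_zero_eq_one]

/-- The character of index `n` is constant on the class of `s` modulo `2`, which carries the masses
of the `n`-gon; so mode `n` of these masses is no new unknown. -/
theorem dft_massAt_half (n : ℕ) [NeZero (2 * n)] (s : ZMod (2 * n)) (w : Fin n → ℝ) :
    ZMod.dft (massAt (fun l : Fin n => s + 2 * ((l : ℕ) : ZMod (2 * n))) w) n =
      ZMod.stdAddChar ((n : ZMod (2 * n)) * s) *
        ZMod.dft (massAt (fun l : Fin n => s + 2 * ((l : ℕ) : ZMod (2 * n))) w) 0 := by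
  rw [ZMod.dft_apply, ZMod.dft_apply]
  simp only [smul_eq_mul, mul_comm _ (massAt _ _ _)]
  rw [sum_massAt, sum_massAt, Finset.mul_sum]
  refine Finset.sum_congr rfl fun l _ => ?_
  have h4 : ((2 * n : ℕ) : ZMod (2 * n)) = 0 := ZMod.natCast_self _
  push_cast at h4
  have : -((s + 2 * ((l : ℕ) : ZMod (2 * n))) * n) = n * s := by
    linear_combination (-s - ((l : ℕ) : ZMod (2 * n))) * h4
  rw [this]; simp; ring

/-- Masses of total zero on the polygons exert no force on the vertices only if they vanish. -/
theorem dft_eq_zero_of_no_force {n N : ℕ} [NeZero N] (hN : N = 2 * n) (h2 : 2 ≤ n) (h236 : n ≤ 236) {ρ : ℝ}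
    (hρ : 0 < ρ) (h1 : ρ ≠ 1) {α β : ZMod N → ℂ} {s : ZMod N} {δ₀ : ℂ}
    (hα : ∀ j, (starRingEnd ℂ) (α j) = α j) (hβ : ∀ j, (starRingEnd ℂ) (β j) = β j)
    (hαn : ZMod.dft α n = ZMod.stdAddChar ((n : ZMod N) * s) * ZMod.dft α 0)
    (hsum : δ₀ + ∑ j, α j + ∑ j, β j = 0)
    (hout : ∀ i, ∑ j, α j * attraction (ρ * ZMod.stdAddChar (j - i)) +
      ∑ j, β j * attraction ((1 : ℝ) * ZMod.stdAddChar (j - i)) - δ₀ = 0)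
    (hin : ∑ j, α j * attraction ((1 : ℝ) * ZMod.stdAddChar (j - s)) +
      ∑ j, β j * attraction ((ρ⁻¹ : ℝ) * ZMod.stdAddChar (j - s)) - δ₀ = 0) :
    α = 0 ∧ β = 0 ∧ δ₀ = 0 := by
  classical
  have hmode : ∀ k : ZMod N, ZMod.dft α k * attractionDFT N ρ k +
      ZMod.dft β k * attractionDFT N 1 k = (if k = 0 then (N : ℂ) else 0) * δ₀ := by
    intro k
    rw [← dft_sum_attraction, ← dft_sum_attraction, ← Finset.sum_add_distrib]
    have : ∀ i : ZMod N, ZMod.stdAddChar (-(i * k)) * ∑ j, α j * attraction (ρ * ZMod.stdAddChar (j - i))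
        + ZMod.stdAddChar (-(i * k)) * ∑ j, β j * attraction ((1 : ℝ) * ZMod.stdAddChar (j - i))
        = ZMod.stdAddChar (-k * i) * δ₀ := by
      intro i
      rw [show -k * i = -(i * k) by ring]
      linear_combination ZMod.stdAddChar (-(i * k)) * hout i
    rw [Finset.sum_congr rfl fun i _ => this i, ← Finset.sum_mul, sum_stdAddChar_mul]
    simp
  have hz : ∀ m : ZMod N, m ≠ 0 → m ≠ n → ZMod.dft α m = 0 ∧ ZMod.dft β m = 0 :=
    fun m h0 hn => by
      subst hN
      exact modes_eq_zero n hρ h1 hα hβ h0 hn fun k hk => by rw [hmode k, if_neg hk, zero_mul]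
  have hn0 : (n : ZMod N) ≠ 0 := by
    rw [Ne, ZMod.natCast_eq_zero_iff]
    intro h
    have := Nat.le_of_dvd (by omega) h
    omega
  have htwo : ∀ (γ : ZMod N → ℂ) (σ : ℝ), (∀ m, m ≠ 0 → m ≠ (n : ZMod N) → ZMod.dft γ m = 0) →
      N * ∑ j, γ j * attraction (σ * ZMod.stdAddChar (j - s)) = ZMod.dft γ 0 * attractionDFT N σ 0 +
        ZMod.stdAddChar ((n : ZMod N) * s) * ZMod.dft γ n * attractionDFT N σ n := by
    intro γ σ hγ
    rw [sum_attraction_eq_sum_dft, Finset.sum_eq_add (0 : ZMod N) n hn0.symm]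
    · simp
    · intro m _ hm
      rw [hγ m hm.1 hm.2]; simp
    · simp
    · simp
  have hsα : ∑ j, α j = ZMod.dft α 0 := by simp [ZMod.dft_apply]
  have hsβ : ∑ j, β j = ZMod.dft β 0 := by simp [ZMod.dft_apply]
  rw [hsα, hsβ] at hsum
  have eII := congrArg (fun z => (N : ℂ) * z) hin
  simp only [mul_sub, mul_add, mul_zero] at eII
  rw [htwo α 1 (fun m a b => (hz m a b).1), htwo β ρ⁻¹ (fun m a b => (hz m a b).2), hαn] at eII
  have eI := hmode 0
  have eIII := hmode n
  rw [if_pos rfl] at eI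
  rw [if_neg hn0, zero_mul, hαn] at eIII
  have hε : (ZMod.stdAddChar ((n : ZMod N) * s) : ℂ) * ZMod.stdAddChar ((n : ZMod N) * s) = 1 := by
    subst hN; exact stdAddChar_half_sq n s
  set ε : ℂ := ZMod.stdAddChar ((n : ZMod N) * s) with hεd
  have huv := (attractionDFT_re_mul_inv_neg N hρ h1 0 0).2
  have hst := (attractionDFT_re_mul_inv_neg N hρ h1 n n).1
  have hκ : 0 < (attractionDFT N 1 n).re := by
    subst hN; exact attractionDFT_one_re_pos n n le_rfl (by omega)
  have hκ' : (attractionDFT N 1 n).re = polygonAttraction N - 2 * polygonAttraction n := by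
    subst hN; exact attractionDFT_one_half_re n
  have hΓ := attractionDFT_one_zero_re N
  have g1 := polygonAttraction_lt h2 (by omega)
  have g2 := polygonAttraction_lt (N := N) (by omega) (by omega)
  rw [attractionDFT_eq_re _ ρ, attractionDFT_eq_re _ 1] at eI eIII
  rw [attractionDFT_eq_re N 1 0, attractionDFT_eq_re N 1 n, attractionDFT_eq_re N ρ⁻¹ 0,
    attractionDFT_eq_re N ρ⁻¹ n] at eII
  have hNr : (N : ℝ) = 2 * n := by rw [hN]; push_cast; ring
  set u₀ := (attractionDFT N ρ 0).re
  set v₀ := (attractionDFT N ρ⁻¹ 0).re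
  set p := (attractionDFT N ρ n).re
  set q := (attractionDFT N ρ⁻¹ n).re
  set κ := (attractionDFT N 1 n).re
  set c := (attractionDFT N 1 0).re
  set A := ZMod.dft α 0
  set B := ZMod.dft β 0
  set C := ZMod.dft β n
  -- The bounds `Γ_n < n` and `Γ_{2n} < 2n` enter here: they make `N + c` and `N + c + κ` positive,
  -- so that all three signed terms are positive.
  have hdet : 0 < (N + c + κ) * ((N + c) * κ) - (N + u₀) * (N + v₀) * κ - p * q * (N + c) := by
    have a1 : 0 < N + c := by linarith
    have a2 : 0 < N + c + κ := by linarith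
    have := mul_pos a2 (mul_pos a1 hκ)
    have := mul_neg_of_neg_of_pos huv hκ
    have := mul_neg_of_neg_of_pos hst a1
    linarith
  have hA : A = 0 := by
    have hdet' : ((N + c + κ) * ((N + c) * κ) - (N + u₀) * (N + v₀) * κ - p * q * (N + c) : ℂ)
        ≠ 0 := by exact_mod_cast hdet.ne'
    apply (mul_eq_zero.1 (?_ : ((N + c + κ) * ((N + c) * κ) - (N + u₀) * (N + v₀) * κ
      - p * q * (N + c) : ℂ) * A = 0)).resolve_left hdet'
    linear_combination ((N + c) * κ : ℂ) * eII + (N * (N + c) * κ : ℂ) * hsum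
      - ((N + c) * κ * κ * A : ℂ) * hε - ((N + v₀) * κ : ℂ) * (eI + N * hsum)
      - ε * q * (N + c) * eIII + (p * q * (N + c) * A : ℂ) * hε
  have hB : B = 0 := by
    have a1 : (N + c : ℂ) ≠ 0 := by
      have : N + c ≠ 0 := by linarith
      exact_mod_cast this
    apply (mul_eq_zero.1 (?_ : (N + c : ℂ) * B = 0)).resolve_left a1
    linear_combination eI + N * hsum - (u₀ + N : ℂ) * hA
  have hC : C = 0 := by
    have a1 : (κ : ℂ) ≠ 0 := by exact_mod_cast hκ.ne'
    apply (mul_eq_zero.1 (?_ : (κ : ℂ) * C = 0)).resolve_left a1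
    linear_combination eIII - (ε * p : ℂ) * hA
  refine ⟨?_, ?_, by rw [hA, hB] at hsum; simpa using hsum⟩
  · rw [← ZMod.dft.map_eq_zero_iff]
    funext m
    by_cases h0 : m = 0
    · rw [h0]; exact hA
    by_cases hn' : m = n
    · rw [hn', hαn, hA, mul_zero]; rfl
    exact (hz m h0 hn').1
  · rw [← ZMod.dft.map_eq_zero_iff]
    funext m
    by_cases h0 : m = 0
    · rw [h0]; exact hB
    by_cases hn' : m = n
    · rw [hn']; exact hC
    exact (hz m h0 hn').2

theorem stdAddChar_eq_exp {N : ℕ} [NeZero N] (φ : ℝ) (k : ℤ) :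
    exp (I * (φ + 2 * Real.pi * k / N : ℝ)) =
      exp (I * φ) * ZMod.stdAddChar ((k : ℤ) : ZMod N) := by
  rw [ZMod.stdAddChar_coe, ← Complex.exp_add]
  congr 1; push_cast; ring

theorem IsPolygonConfiguration.exists_stdAddChar {n : ℕ} [NeZero (2 * n)] {x : Body n → ℂ}
    (h : IsPolygonConfiguration n x) : x (Sum.inl ()) = 0 ∧
    ∃ (r R : ℝ) (c : ℂ) (s : ZMod (2 * n)), 0 < r ∧ 0 < R ∧ c ≠ 0 ∧
      (∀ l : Fin n, x (Sum.inr (Sum.inl l)) =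
        r * (c * ZMod.stdAddChar (s + 2 * ((l : ℕ) : ZMod (2 * n))))) ∧
      (∀ l : Fin (2 * n), x (Sum.inr (Sum.inr l)) =
        R * (c * ZMod.stdAddChar ((l : ℕ) : ZMod (2 * n)))) := by
  obtain ⟨h0, r, R, φ, s, hr, hR, h1, h2⟩ := h
  refine ⟨h0, r, R, exp (I * φ), s, hr, hR, exp_ne_zero _, fun l => ?_, fun l => ?_⟩
  · rw [h1]
    have := stdAddChar_eq_exp (N := 2 * n) φ (s + 2 * (l : ℕ))
    have hn : (n : ℝ) ≠ 0 := by
      have := NeZero.ne (2 * n)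
      exact_mod_cast (by omega : n ≠ 0)
    push_cast at this ⊢
    rw [← this]
    congr 3
    have hn' : (n : ℂ) ≠ 0 := by exact_mod_cast hn
    field_simp
    ring
  · rw [h2]
    have := stdAddChar_eq_exp (N := 2 * n) φ ((l : ℕ) : ℤ)
    push_cast at this ⊢
    rw [← this]

theorem not_isReallyPerverse {n : ℕ} (hn : 2 ≤ n) (h236 : n ≤ 236) {x : Body n → ℂ}
    {X : ℝ → Body n → ℂ} {m : Body n → ℝ} (hx : IsPolygonConfiguration n x)
    (hX : IsUniformRotation x X) : ¬ IsReallyPerverse m X := by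
  rintro ⟨m', h1, h2, hne, hsum, -⟩
  have : NeZero (2 * n) := ⟨by omega⟩
  obtain ⟨hx0, r, R, c, s, hr, hR, hc, hin, hout⟩ := hx.exists_stdAddChar
  have hX0 := hX.apply_zero
  have hinj : Function.Injective x := hX0 ▸ h1.1 0
  have he : ∀ j : ZMod (2 * n), (ZMod.stdAddChar j : ℂ) ≠ 0 := fun j => by
    rw [← norm_ne_zero_iff, norm_stdAddChar]; exact one_ne_zero
  have hr' : (r : ℂ) ≠ 0 := by exact_mod_cast hr.ne'
  have hR' : (R : ℂ) ≠ 0 := by exact_mod_cast hR.ne'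
  have hout' : ∀ i : ZMod (2 * n), x (Sum.inr (Sum.inr ⟨i.val, i.val_lt⟩)) =
      R * (c * ZMod.stdAddChar i) := fun i => by rw [hout]; simp
  -- With equal radii each vertex of the `n`-gon would collide with one of the `2n`-gon.
  have hrR : r / R ≠ 1 := by
    intro h
    rw [div_eq_one_iff_eq hR.ne'] at h
    have e1 := hin ⟨0, by omega⟩
    rw [h] at e1
    simp only [Nat.cast_zero, mul_zero, add_zero] at e1
    rw [← hout' s] at e1
    simpa using hinj e1
  set w : Body n → ℝ := fun i => m' i - m i with hw
  set p : Fin n → ZMod (2 * n) := fun l => s + 2 * ((l : ℕ) : ZMod (2 * n)) with hp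
  set q : Fin (2 * n) → ZMod (2 * n) := fun l => ((l : ℕ) : ZMod (2 * n)) with hq
  set α := massAt p (fun l => w (Sum.inr (Sum.inl l))) with hα
  set β := massAt q (fun l => w (Sum.inr (Sum.inr l))) with hβ
  have hforce : ∀ i, x i ≠ 0 → ∑ j, (w j : ℂ) * attraction (x j / x i) = 0 := by
    intro i hi
    have := sum_sub_attraction_eq_zero h1 h2 i (by rwa [hX0])
    rwa [hX0] at this
  have hsplit : ∀ y : ℂ, ∑ j, (w j : ℂ) * attraction (x j / y) =
      ∑ j, α j * attraction (r * (c * ZMod.stdAddChar j) / y) +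
        ∑ j, β j * attraction (R * (c * ZMod.stdAddChar j) / y) - w (Sum.inl ()) := by
    intro y
    rw [Fintype.sum_sum_type, Fintype.sum_sum_type, hα, hβ,
      sum_massAt p _ (fun j => attraction (r * (c * ZMod.stdAddChar j) / y)),
      sum_massAt q _ (fun j => attraction (R * (c * ZMod.stdAddChar j) / y))]
    simp only [hin, hout, hx0, zero_div, attraction_zero, Finset.univ_unique,
      Finset.sum_singleton, hp, hq]
    ring
  have hquot : ∀ (a b : ℂ) (i j : ZMod (2 * n)), a * (c * ZMod.stdAddChar j) /
      (b * (c * ZMod.stdAddChar i)) = a / b * ZMod.stdAddChar (j - i) := by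
    intro a b i j
    rw [AddChar.map_sub_eq_div]
    have := he i
    by_cases hb : b = 0
    · simp [hb]
    field_simp
  have hmass : (w (Sum.inl ()) : ℂ) + ∑ j, α j + ∑ j, β j = 0 := by
    have e1 := sum_massAt p (fun l => w (Sum.inr (Sum.inl l))) (fun _ => 1)
    have e2 := sum_massAt q (fun l => w (Sum.inr (Sum.inr l))) (fun _ => 1)
    simp only [mul_one] at e1 e2
    rw [hα, hβ, e1, e2]
    have : ∑ i, w i = 0 := by simp only [hw]; rw [Finset.sum_sub_distrib, hsum, sub_self]
    rw [Fintype.sum_sum_type, Fintype.sum_sum_type] at this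
    simp only [Finset.univ_unique, Finset.sum_singleton] at this
    rw [← add_assoc] at this
    exact_mod_cast this
  have hforce_out : ∀ i, ∑ j, α j * attraction ((r / R : ℝ) * ZMod.stdAddChar (j - i)) +
      ∑ j, β j * attraction ((1 : ℝ) * ZMod.stdAddChar (j - i)) - w (Sum.inl ()) = 0 := by
    intro i
    have hi : R * (c * (ZMod.stdAddChar i : ℂ)) ≠ 0 := mul_ne_zero hR' (mul_ne_zero hc (he i))
    have := hforce (Sum.inr (Sum.inr ⟨i.val, i.val_lt⟩)) (by rw [hout']; exact hi)
    rw [hsplit, hout'] at this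
    simp only [hquot, div_self hR'] at this
    push_cast
    exact this
  have hforce_in : ∑ j, α j * attraction ((1 : ℝ) * ZMod.stdAddChar (j - s)) +
      ∑ j, β j * attraction (((r / R)⁻¹ : ℝ) * ZMod.stdAddChar (j - s)) - w (Sum.inl ()) = 0 := by
    have e : x (Sum.inr (Sum.inl ⟨0, by omega⟩)) = r * (c * ZMod.stdAddChar s) := by
      rw [hin]; simp
    have := hforce (Sum.inr (Sum.inl ⟨0, by omega⟩))
      (by rw [e]; exact mul_ne_zero hr' (mul_ne_zero hc (he s)))
    rw [hsplit, e] at this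
    simp only [hquot, div_self hr'] at this
    push_cast
    rw [inv_div]
    exact this
  obtain ⟨a1, a2, a3⟩ : α = 0 ∧ β = 0 ∧ (w (Sum.inl ()) : ℂ) = 0 :=
    dft_eq_zero_of_no_force (N := 2 * n) rfl hn h236 (div_pos hr hR) hrR
    (massAt_conj _ _) (massAt_conj _ _) (dft_massAt_half n s _) hmass hforce_out hforce_in
  have hpinj : Function.Injective p := by
    intro l l' h
    have : x (Sum.inr (Sum.inl l)) = x (Sum.inr (Sum.inl l')) := by
      rw [hin, hin]; simp only [hp] at h; rw [h]
    simpa using hinj this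
  have hqinj : Function.Injective q := by
    intro l l' h
    have : x (Sum.inr (Sum.inr l)) = x (Sum.inr (Sum.inr l')) := by
      rw [hout, hout]; simp only [hq] at h; rw [h]
    simpa using hinj this
  apply hne
  funext i
  apply sub_eq_zero.1
  change w i = 0
  rcases i with ⟨⟩ | l | l
  · exact_mod_cast a3
  · have := massAt_apply hpinj (fun l => w (Sum.inr (Sum.inl l))) l
    rw [← hα, a1, Pi.zero_apply] at this
    exact_mod_cast this.symm
  · have := massAt_apply hqinj (fun l => w (Sum.inr (Sum.inr l))) l
    rw [← hβ, a2, Pi.zero_apply] at this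
    exact_mod_cast this.symm

/-! ### Sufficient conditions for a polygonal relative equilibrium. -/

/-- A configuration on which the attraction is proportional to the position is in relative
equilibrium. -/
theorem isNBodySolution_of_central {ι : Type} [Fintype ι] [DecidableEq ι] {m : ι → ℝ} {x : ι → ℂ}
    (hx : Function.Injective x) (ω : ℝ)
    (h : ∀ i, ∑ j ∈ Finset.univ.erase i, (m j / ‖x j - x i‖ ^ 3) • (x j - x i) =
      -((ω ^ 2 : ℝ) : ℂ) * x i) :
    IsNBodySolution m (fun t i => exp (I * (ω * t : ℝ)) * x i) := by
  have hexp : ∀ t : ℝ, HasDerivAt (fun t : ℝ => exp (I * (ω * t : ℝ)))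
      (exp (I * (ω * t : ℝ)) * (I * ω)) t := by
    intro t
    have h1 : HasDerivAt (fun t : ℝ => I * ((ω * t : ℝ) : ℂ)) (I * ω) t := by
      have := ((hasDerivAt_id t).const_mul ω).ofReal_comp.const_mul I
      simpa using this
    exact h1.cexp
  refine ⟨fun t i j hij => hx (mul_left_cancel₀ (exp_ne_zero _) hij),
    fun t i => exp (I * (ω * t : ℝ)) * (I * ω) * x i, fun t i => ⟨(hexp t).mul_const _, ?_⟩⟩
  have h2 := ((hexp t).mul_const (I * ω)).mul_const (x i)
  refine h2.congr_deriv ?_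
  have h3 : ∀ j, (m j / ‖exp (I * (ω * t : ℝ)) * x j - exp (I * (ω * t : ℝ)) * x i‖ ^ 3) •
      (exp (I * (ω * t : ℝ)) * x j - exp (I * (ω * t : ℝ)) * x i) =
      exp (I * (ω * t : ℝ)) * ((m j / ‖x j - x i‖ ^ 3) • (x j - x i)) := by
    intro j
    rw [← mul_sub, norm_mul, mul_comm I, Complex.norm_exp_ofReal_mul_I, one_mul, mul_smul_comm]
  rw [Finset.sum_congr rfl fun j _ => h3 j, ← Finset.mul_sum, h]
  push_cast
  linear_combination exp (I * (ω * t)) * x i * ω ^ 2 * I_sq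

theorem stdAddChar_half (n : ℕ) [NeZero (2 * n)] (l : ℕ) :
    (ZMod.stdAddChar ((n : ZMod (2 * n)) * (l : ZMod (2 * n))) : ℂ) = (-1) ^ l := by
  have hn : (n : ℝ) ≠ 0 := by
    have := NeZero.ne (2 * n)
    exact_mod_cast (by omega : n ≠ 0)
  rw [mul_comm (n : ZMod (2 * n)), ← nsmul_eq_mul, AddChar.map_nsmul_eq_pow, stdAddChar_natCast]
  have : 2 * (Real.pi * n / (2 * n : ℕ)) = Real.pi := by push_cast; field_simp
  rw [this, Complex.exp_pi_mul_I]

/-- A regular `n`-gon of radius `ρ` and a regular `2n`-gon of radius `1`, with a common axis. -/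
noncomputable def polygonConfiguration (n : ℕ) [NeZero (2 * n)] (ρ : ℝ) : Body n → ℂ
  | Sum.inl _ => 0
  | Sum.inr (Sum.inl l) => ρ * ZMod.stdAddChar (((2 * l : ℕ) : ℕ) : ZMod (2 * n))
  | Sum.inr (Sum.inr l) => ZMod.stdAddChar (((l : ℕ) : ℕ) : ZMod (2 * n))

theorem isPolygonConfiguration_polygonConfiguration (n : ℕ) [NeZero (2 * n)] {ρ : ℝ}
    (hρ : 0 < ρ) : IsPolygonConfiguration n (polygonConfiguration n ρ) := by
  refine ⟨rfl, ρ, 1, 0, 0, hρ, one_pos, fun l => ?_, fun l => ?_⟩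
  · rw [polygonConfiguration, stdAddChar_natCast]
    congr 2
    push_cast
    have hn : (n : ℂ) ≠ 0 := by
      have := NeZero.ne (2 * n)
      exact_mod_cast (by omega : n ≠ 0)
    field_simp
    ring
  · rw [polygonConfiguration, stdAddChar_natCast]
    push_cast
    rw [one_mul]
    congr 1
    ring

theorem polygonConfiguration_injective (n : ℕ) [NeZero (2 * n)] {ρ : ℝ} (h0 : 0 < ρ)
    (h1 : ρ < 1) : Function.Injective (polygonConfiguration n ρ) := by
  have hρ : (ρ : ℂ) ≠ 0 := by exact_mod_cast h0.ne'
  have hcast : ∀ a b : ℕ, a < 2 * n → b < 2 * n →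
      (ZMod.stdAddChar (a : ZMod (2 * n)) : ℂ) = ZMod.stdAddChar (b : ZMod (2 * n)) → a = b := by
    intro a b ha hb h
    have := ZMod.injective_stdAddChar h
    rw [ZMod.natCast_eq_natCast_iff', Nat.mod_eq_of_lt ha, Nat.mod_eq_of_lt hb] at this
    exact this
  have hn1 : ∀ l, ‖polygonConfiguration n ρ (Sum.inr (Sum.inl l))‖ = ρ := by
    intro l
    rw [polygonConfiguration, norm_mul, norm_stdAddChar, Complex.norm_real,
      Real.norm_of_nonneg h0.le, mul_one]
  have hn2 : ∀ l, ‖polygonConfiguration n ρ (Sum.inr (Sum.inr l))‖ = 1 := fun l =>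
    norm_stdAddChar _
  have hn0 : ∀ u, ‖polygonConfiguration n ρ (Sum.inl u)‖ = 0 := fun u => norm_zero
  intro i j hij
  have hnorm := congrArg norm hij
  rcases i with ⟨⟩ | l | l <;> rcases j with ⟨⟩ | l' | l' <;>
    simp only [hn0, hn1, hn2] at hnorm
  · rfl
  · linarith
  · linarith
  · linarith
  · have := hcast _ _ (by omega) (by omega) (mul_left_cancel₀ hρ hij)
    rw [Fin.ext (by omega : (l : ℕ) = l')]
  · linarith
  · linarith
  · linarith
  · have := hcast _ _ l.2 l'.2 hij
    rw [Fin.ext this]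

/-- Only modes `0` and `n` occur: on `ZMod (2 * n)` the masses of the `n`-gon are `μ 1 / 2` times `1
+ (-1) ^ j`, and the alternating ones are a mean plus `(-1) ^ j` times half a difference. -/
theorem sum_polygonMasses_mul (n : ℕ) [NeZero (2 * n)] (ρ : ℝ) (μ : Fin 4 → ℝ) (g : ℂ → ℂ) :
    ∑ i, (polygonMasses n μ i : ℂ) * g (polygonConfiguration n ρ i) = μ 0 * g 0 +
      μ 1 / 2 * (∑ j : ZMod (2 * n), g (ρ * ZMod.stdAddChar j) +
        ∑ j : ZMod (2 * n), ZMod.stdAddChar ((n : ZMod (2 * n)) * j) * g (ρ * ZMod.stdAddChar j)) +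
      ((μ 2 + μ 3) / 2 * ∑ j : ZMod (2 * n), g (ZMod.stdAddChar j) +
        (μ 2 - μ 3) / 2 *
          ∑ j : ZMod (2 * n), ZMod.stdAddChar ((n : ZMod (2 * n)) * j) * g (ZMod.stdAddChar j)) := by
  rw [Fintype.sum_sum_type, Fintype.sum_sum_type]
  simp only [Finset.univ_unique, Finset.sum_singleton, polygonMasses, polygonConfiguration]
  rw [Fin.sum_univ_eq_sum_range (fun l => (μ 1 : ℂ) *
      g (ρ * ZMod.stdAddChar (((2 * l : ℕ) : ℕ) : ZMod (2 * n)))),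
    ← sum_range_two_mul_even n (fun l => (μ 1 : ℂ) *
      g (ρ * ZMod.stdAddChar ((l : ℕ) : ZMod (2 * n)))),
    Fin.sum_univ_eq_sum_range (fun l => ((if Even l then μ 2 else μ 3 : ℝ) : ℂ) *
      g (ZMod.stdAddChar ((l : ℕ) : ZMod (2 * n)))), sum_zmod_eq_sum_range, sum_zmod_eq_sum_range,
    sum_zmod_eq_sum_range, sum_zmod_eq_sum_range, add_assoc]
  congr 2
  · rw [← Finset.sum_add_distrib, Finset.mul_sum]
    refine Finset.sum_congr rfl fun l _ => ?_
    rw [stdAddChar_half]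
    split_ifs with hl
    · rw [hl.neg_one_pow]; ring
    · rw [(Nat.not_even_iff_odd.1 hl).neg_one_pow]; ring
  · rw [Finset.mul_sum, Finset.mul_sum, ← Finset.sum_add_distrib]
    refine Finset.sum_congr rfl fun l _ => ?_
    rw [stdAddChar_half]
    split_ifs with hl
    · rw [hl.neg_one_pow]; ring
    · rw [(Nat.not_even_iff_odd.1 hl).neg_one_pow]; ring

/-- The sums involve characters `1` and `n + 1`, both nontrivial for `n ≥ 2`. The cases `z / ‖z‖ ^
3` and `id` give the force on the central body and the center of mass. -/
theorem sum_polygonMasses_mul_of_homogeneous {n : ℕ} [NeZero (2 * n)] (hn : 2 ≤ n) (ρ : ℝ)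
    (μ : Fin 4 → ℝ) {g : ℂ → ℂ} (hg : ∀ (a : ℝ) (z : ℂ), ‖z‖ = 1 → g (a * z) = g a * z)
    (h0 : g 0 = 0) :
    ∑ i, (polygonMasses n μ i : ℂ) * g (polygonConfiguration n ρ i) = 0 := by
  have h4 : ((2 * n : ℕ) : ZMod (2 * n)) = 0 := ZMod.natCast_self _
  have e1 : ∑ j : ZMod (2 * n), (ZMod.stdAddChar j : ℂ) = 0 := by
    have := sum_stdAddChar_mul (2 * n) 1
    simp only [one_mul] at this
    rw [this, if_neg]
    have : ((1 : ℕ) : ZMod (2 * n)) ≠ 0 := by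
      rw [Ne, ZMod.natCast_eq_zero_iff]
      intro h; have := Nat.le_of_dvd one_pos h; omega
    simpa using this
  have e2 : ∑ j : ZMod (2 * n), (ZMod.stdAddChar ((n : ZMod (2 * n)) * j) : ℂ) *
      ZMod.stdAddChar j = 0 := by
    have := sum_stdAddChar_mul (2 * n) ((n + 1 : ℕ) : ZMod (2 * n))
    rw [if_neg] at this
    · rw [← this]
      refine Finset.sum_congr rfl fun j _ => ?_
      rw [← AddChar.map_add_eq_mul]
      congr 1; push_cast; ring
    · rw [ZMod.natCast_eq_zero_iff]
      intro h; have := Nat.le_of_dvd (by omega) h; omega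
  have e3 : ∀ z : ℂ, ‖z‖ = 1 → g z = g 1 * z := fun z hz => by
    have := hg 1 z hz
    simpa using this
  rw [sum_polygonMasses_mul, h0]
  simp only [hg _ _ (norm_stdAddChar _), e3 _ (norm_stdAddChar _), mul_left_comm _ (g _) _,
    ← Finset.mul_sum, e1, e2]
  ring

/-- The hypotheses `e1`, `e2` are the modes `0` and `n` of the equations on the `2n`-gon, and `e3`
is the equation at a vertex of the `n`-gon, where the normalisation of the kernel produces `ρ ^ 3`.
-/
theorem isNBodySolution_polygonConfiguration {n : ℕ} [NeZero (2 * n)] (hn : 2 ≤ n) {ρ : ℝ}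
    (h0 : 0 < ρ) (h1 : ρ < 1) {μ : Fin 4 → ℝ} {ω : ℝ}
    (e1 : -μ 0 + μ 1 / 2 * (attractionDFT (2 * n) ρ 0).re +
      (μ 2 + μ 3) / 2 * (attractionDFT (2 * n) 1 0).re = -ω ^ 2)
    (e2 : μ 1 / 2 * (attractionDFT (2 * n) ρ n).re +
      (μ 2 - μ 3) / 2 * (attractionDFT (2 * n) 1 n).re = 0)
    (e3 : -μ 0 + μ 1 / 2 * ((attractionDFT (2 * n) 1 0).re + (attractionDFT (2 * n) 1 n).re) +
      (μ 2 + μ 3) / 2 * (attractionDFT (2 * n) ρ⁻¹ 0).re +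
      (μ 2 - μ 3) / 2 * (attractionDFT (2 * n) ρ⁻¹ n).re = -ω ^ 2 * ρ ^ 3) :
    IsNBodySolution (polygonMasses n μ)
      (fun t i => exp (I * (ω * t : ℝ)) * polygonConfiguration n ρ i) := by
  refine isNBodySolution_of_central (polygonConfiguration_injective n h0 h1) ω fun i => ?_
  have hρ : (ρ : ℂ) ≠ 0 := by exact_mod_cast h0.ne'
  have he : ∀ j : ZMod (2 * n), (ZMod.stdAddChar j : ℂ) ≠ 0 := fun j => by
    rw [← norm_ne_zero_iff, norm_stdAddChar]; exact one_ne_zero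
  have hquot : ∀ (a b : ℂ) (i j : ZMod (2 * n)), a * ZMod.stdAddChar j /
      (b * ZMod.stdAddChar i) = a / b * ZMod.stdAddChar (j - i) := by
    intro a b i j
    rw [AddChar.map_sub_eq_div]
    have := he i
    by_cases hb : b = 0
    · simp [hb]
    field_simp
  have hS0 : ∀ (σ : ℝ) (i : ZMod (2 * n)), ∑ j, attraction (σ * ZMod.stdAddChar (j - i)) =
      (attractionDFT (2 * n) σ 0).re := by
    intro σ i
    have := sum_stdAddChar_mul_attraction (N := 2 * n) σ 0 i
    rw [attractionDFT_eq_re] at this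
    simpa using this
  have hSn : ∀ (σ : ℝ) (i : ZMod (2 * n)), ∑ j, ZMod.stdAddChar ((n : ZMod (2 * n)) * j) *
      attraction (σ * ZMod.stdAddChar (j - i)) =
      ZMod.stdAddChar ((n : ZMod (2 * n)) * i) * (attractionDFT (2 * n) σ n).re := by
    intro σ i
    rw [sum_stdAddChar_mul_attraction, ← attractionDFT_eq_re]
  have hsum : ∀ (b : ℝ) (i : ZMod (2 * n)), ∑ j, (polygonMasses n μ j : ℂ) *
      attraction (polygonConfiguration n ρ j / (b * ZMod.stdAddChar i)) = -μ 0 +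
      μ 1 / 2 * ((attractionDFT (2 * n) (ρ / b) 0).re +
        ZMod.stdAddChar ((n : ZMod (2 * n)) * i) * (attractionDFT (2 * n) (ρ / b) n).re) +
      ((μ 2 + μ 3) / 2 * (attractionDFT (2 * n) (1 / b) 0).re + (μ 2 - μ 3) / 2 *
        (ZMod.stdAddChar ((n : ZMod (2 * n)) * i) * (attractionDFT (2 * n) (1 / b) n).re)) := by
    intro b i
    rw [sum_polygonMasses_mul n ρ μ (fun z => attraction (z / (b * ZMod.stdAddChar i))),
      zero_div, attraction_zero]
    have : ∀ j : ZMod (2 * n), (ZMod.stdAddChar j : ℂ) / (b * ZMod.stdAddChar i) =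
        ((1 / b : ℝ) : ℂ) * ZMod.stdAddChar (j - i) := by
      intro j
      have := hquot 1 b i j
      rw [one_mul] at this
      rw [this]; push_cast; rfl
    simp only [hquot, this, ← Complex.ofReal_div, hS0, hSn]
    ring
  rcases i with ⟨⟩ | l | l
  · have h := sum_polygonMasses_mul_of_homogeneous hn ρ μ (g := fun z => z / (‖z‖ : ℂ) ^ 3)
      (fun a z hz => by
        simp only [norm_mul, hz, mul_one]; ring) (by simp)
    have h' : polygonConfiguration n ρ (Sum.inl ()) = 0 := rfl
    rw [h', mul_zero]
    refine Eq.trans ?_ h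
    rw [← Finset.add_sum_erase _ _ (Finset.mem_univ (Sum.inl ())), h']
    simp only [sub_zero, zero_div, mul_zero, zero_add]
    refine Finset.sum_congr rfl fun j _ => ?_
    rw [Complex.real_smul]; push_cast; ring
  · have hx : polygonConfiguration n ρ (Sum.inr (Sum.inl l)) =
      ρ * ZMod.stdAddChar (((2 * l : ℕ) : ℕ) : ZMod (2 * n)) := rfl
    have hne : polygonConfiguration n ρ (Sum.inr (Sum.inl l)) ≠ 0 := by
      rw [hx]; exact mul_ne_zero hρ (he _)
    rw [sum_attraction _ _ _ hne, hx, hsum, stdAddChar_half, norm_mul, norm_stdAddChar,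
      Complex.norm_real, Real.norm_of_nonneg h0.le, div_self h0.ne', one_div]
    have e3' := congrArg (Complex.ofReal) e3
    push_cast at e3' ⊢
    rw [pow_mul, neg_one_sq, one_pow]
    have hρ3 : (ρ : ℂ) * ((ρ : ℂ) ^ 3)⁻¹ * (ρ : ℂ) ^ 3 = ρ := by field_simp
    linear_combination (ρ * ZMod.stdAddChar (2 * ((l : ℕ) : ZMod (2 * n))) / ρ ^ 3) * e3' -
      ω ^ 2 * ZMod.stdAddChar (2 * ((l : ℕ) : ZMod (2 * n))) * hρ3
  · have hx : polygonConfiguration n ρ (Sum.inr (Sum.inr l)) =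
      (1 : ℝ) * ZMod.stdAddChar ((l : ℕ) : ZMod (2 * n)) := by
      rw [Complex.ofReal_one, one_mul]; rfl
    have hne : polygonConfiguration n ρ (Sum.inr (Sum.inr l)) ≠ 0 := by
      rw [hx, Complex.ofReal_one, one_mul]; exact he _
    rw [sum_attraction _ _ _ hne, hx, hsum, norm_mul, norm_stdAddChar]
    have e1' := congrArg (Complex.ofReal) e1
    have e2' := congrArg (Complex.ofReal) e2
    simp only [div_one, Complex.ofReal_one, norm_one, one_mul, one_pow, mul_one]
    push_cast at e1' e2' ⊢
    linear_combination (ZMod.stdAddChar ((l : ℕ) : ZMod (2 * n)) : ℂ) * (e1' +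
      ZMod.stdAddChar ((n : ZMod (2 * n)) * ((l : ℕ) : ZMod (2 * n))) * e2')

theorem sum_polygonMasses (n : ℕ) (μ : Fin 4 → ℝ) :
    ∑ i, polygonMasses n μ i = μ 0 + n * (μ 1 + μ 2 + μ 3) := by
  rw [Fintype.sum_sum_type, Fintype.sum_sum_type]
  simp only [Finset.univ_unique, polygonMasses, Finset.sum_const,
    Finset.card_univ, Fintype.card_fin, nsmul_eq_mul, Finset.card_singleton, Nat.cast_one, one_mul]
  have : ∀ k : ℕ, ∑ l ∈ Finset.range (2 * k), (if Even l then μ 2 else μ 3) =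
      k * (μ 2 + μ 3) := by
    intro k
    induction k with
    | zero => simp
    | succ k ih =>
      rw [show 2 * (k + 1) = 2 * k + 1 + 1 by ring, Finset.sum_range_succ, Finset.sum_range_succ, ih]
      simp; ring
  rw [Fin.sum_univ_eq_sum_range (fun l => if Even l then μ 2 else μ 3), this]
  ring

theorem centerMass_polygonMasses {n : ℕ} [NeZero (2 * n)] (hn : 2 ≤ n) (ρ ω t : ℝ)
    (μ : Fin 4 → ℝ) : Finset.univ.centerMass (polygonMasses n μ)
      (fun i => exp (I * (ω * t : ℝ)) * polygonConfiguration n ρ i) = 0 := by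
  rw [Finset.centerMass]
  have := sum_polygonMasses_mul_of_homogeneous hn ρ μ (g := id) (fun a z _ => rfl) rfl
  simp only [id] at this
  simp only [Complex.real_smul, mul_left_comm _ (exp _)]
  rw [← Finset.mul_sum, this]
  simp

/-! ### Existence for `n ≥ 237`. -/

/-- `(1 - ρ) ^ 2 * attractionDFT N ρ m`, extended by continuity to `ρ = 1`. -/
noncomputable def regularizedDFT (N : ℕ) [NeZero N] (m : ZMod N) (ρ : ℝ) : ℝ :=
  -1 + (1 - ρ) ^ 2 * ∑ d ∈ Finset.univ.erase (0 : ZMod N),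
    (attraction (ρ * ZMod.stdAddChar d) * ZMod.stdAddChar (m * d)).re

theorem regularizedDFT_eq (N : ℕ) [NeZero N] (m : ZMod N) {ρ : ℝ} (h : ρ < 1) :
    regularizedDFT N m ρ = (1 - ρ) ^ 2 * (attractionDFT N ρ m).re := by
  rw [regularizedDFT, attractionDFT, ← Finset.add_sum_erase _ _ (Finset.mem_univ (0 : ZMod N)),
    Complex.add_re, Complex.re_sum, mul_add]
  congr 1
  -- Only the nearest vertex, `d = 0`, is singular as `ρ → 1`; its regularised contribution is the
  -- constant `-1`.
  have h1 : attraction (ρ : ℂ) = ((-((1 - ρ) ^ 2)⁻¹ : ℝ) : ℂ) := by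
    have h2 : ‖(ρ : ℂ) - 1‖ = 1 - ρ := by
      rw [← Complex.ofReal_one, ← Complex.ofReal_sub, Complex.norm_real, Real.norm_eq_abs,
        abs_of_neg (by linarith)]
      ring
    have h3 : (1 - ρ : ℂ) ≠ 0 := by
      have : 1 - ρ ≠ 0 := by linarith
      exact_mod_cast this
    rw [attraction, h2]
    push_cast
    field_simp
    ring
  have h3 : (1 - ρ) ^ 2 ≠ 0 := pow_ne_zero _ (by linarith)
  simp only [AddChar.map_zero_eq_one, mul_one, mul_zero, h1, Complex.ofReal_re]
  rw [mul_neg, mul_inv_cancel₀ h3]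

theorem regularizedDFT_continuousOn (N : ℕ) [NeZero N] (m : ZMod N) :
    ContinuousOn (regularizedDFT N m) (Set.Icc 0 1) := by
  unfold regularizedDFT
  refine continuousOn_const.add (ContinuousOn.mul (by fun_prop)
    (continuousOn_finsetSum _ fun d hd => ?_))
  refine Complex.continuous_re.comp_continuousOn (ContinuousOn.mul ?_ continuousOn_const)
  unfold attraction
  refine ContinuousOn.div (by fun_prop) (by fun_prop) fun ρ hρ => ?_
  apply pow_ne_zero
  rw [Ne, Complex.ofReal_eq_zero, norm_eq_zero, sub_eq_zero]
  intro h
  have h1 : ρ = 1 := by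
    have := congrArg norm h
    rwa [norm_mul, norm_stdAddChar, Complex.norm_real, Real.norm_of_nonneg hρ.1, mul_one,
      norm_one] at this
  rw [h1, Complex.ofReal_one, one_mul, ← AddChar.map_zero_eq_one (ZMod.stdAddChar (N := N))] at h
  exact (Finset.mem_erase.1 hd).1 (ZMod.injective_stdAddChar h)

theorem regularizedDFT_zero (N : ℕ) [NeZero N] (m : ZMod N) :
    regularizedDFT N m 0 = -(if m = 0 then (N : ℝ) else 0) := by
  rw [regularizedDFT_eq N m one_pos, attractionDFT]
  simp only [Complex.ofReal_zero, zero_mul, attraction_zero, ← Finset.mul_sum,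
    sum_stdAddChar_mul]
  split_ifs <;> simp

theorem regularizedDFT_one (N : ℕ) [NeZero N] (m : ZMod N) : regularizedDFT N m 1 = -1 := by
  simp [regularizedDFT]

theorem exists_degenerate_radius {n : ℕ} [NeZero (2 * n)] (hn : 237 ≤ n) :
    ∃ ρ : ℝ, 0 < ρ ∧ ρ < 1 ∧
      ((2 * n : ℕ) + (attractionDFT (2 * n) 1 0).re + (attractionDFT (2 * n) 1 n).re) *
        (((2 * n : ℕ) + (attractionDFT (2 * n) 1 0).re) * (attractionDFT (2 * n) 1 n).re) -
      ((2 * n : ℕ) + (attractionDFT (2 * n) ρ 0).re) *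
        ((2 * n : ℕ) + (attractionDFT (2 * n) ρ⁻¹ 0).re) * (attractionDFT (2 * n) 1 n).re -
      (attractionDFT (2 * n) ρ n).re * (attractionDFT (2 * n) ρ⁻¹ n).re *
        ((2 * n : ℕ) + (attractionDFT (2 * n) 1 0).re) = 0 := by
  have hκ := attractionDFT_one_re_pos n n le_rfl (by omega)
  have hκ' := attractionDFT_one_half_re n
  have hΓ := attractionDFT_one_zero_re (2 * n)
  have hA := lt_polygonAttraction (N := 2 * n) (by omega)
  have hn0 : (n : ZMod (2 * n)) ≠ 0 := by
    rw [Ne, ZMod.natCast_eq_zero_iff]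
    intro h
    have := Nat.le_of_dvd (by omega) h
    omega
  have hNn : ((2 * n : ℕ) : ℝ) = 2 * n := by push_cast; ring
  set N : ℝ := ((2 * n : ℕ) : ℝ)
  set c := (attractionDFT (2 * n) 1 0).re
  set κ := (attractionDFT (2 * n) 1 n).re
  have hA' : N + c < 0 := by linarith
  -- The sign of `n - Γ_n` is irrelevant, since it is a common factor of both endpoint values of
  -- `H`; only its nonvanishing matters.
  have hB : N + c + κ ≠ 0 := by
    have e : N + c + κ = 2 * (n - polygonAttraction n) := by linarith
    rw [e]
    rcases Nat.lt_or_ge n 473 with h | h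
    · have := polygonAttraction_lt (N := n) (by omega) (by omega)
      exact (by linarith : 0 < 2 * (n - polygonAttraction n)).ne'
    · have := lt_polygonAttraction h
      exact (by linarith : 2 * (n - polygonAttraction n) < 0).ne
  -- This is `(1 - ρ) ^ 4` times the determinant, with the coefficients at `ρ⁻¹` rewritten at `ρ` by
  -- inversion so that it extends continuously to `[0, 1]`.
  set H : ℝ → ℝ := fun ρ => (1 - ρ) ^ 4 * ((N + c + κ) * ((N + c) * κ)) -
    ((1 - ρ) ^ 2 * N + regularizedDFT (2 * n) 0 ρ) *
      ((1 - ρ) ^ 2 * N - ρ ^ 2 * regularizedDFT (2 * n) (-0 - 1) ρ) * κ +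
    regularizedDFT (2 * n) n ρ * (ρ ^ 2 * regularizedDFT (2 * n) (-n - 1) ρ) * (N + c) with hH
  have hcont : ContinuousOn H (Set.Icc 0 1) := by
    have c1 := regularizedDFT_continuousOn (2 * n) 0
    have c2 := regularizedDFT_continuousOn (2 * n) (-0 - 1)
    have c3 := regularizedDFT_continuousOn (2 * n) n
    have c4 := regularizedDFT_continuousOn (2 * n) (-n - 1)
    fun_prop
  have hH0 : H 0 = (N + c + κ) * ((N + c) * κ) := by
    simp only [hH, regularizedDFT_zero, if_pos, if_neg hn0]
    ring
  have hH1 : H 1 = N + c + κ := by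
    simp only [hH, regularizedDFT_one]
    ring
  have hroot : ∃ ρ ∈ Set.Ioo (0 : ℝ) 1, H ρ = 0 := by
    have hneg : (N + c) * κ < 0 := mul_neg_of_neg_of_pos hA' hκ
    rcases lt_or_gt_of_ne hB with h | h
    · exact intermediate_value_Ioo' zero_le_one hcont
        ⟨hH1 ▸ h, hH0 ▸ mul_pos_of_neg_of_neg h hneg⟩
    · exact intermediate_value_Ioo zero_le_one hcont
        ⟨hH0 ▸ mul_neg_of_pos_of_neg h hneg, hH1 ▸ h⟩
  obtain ⟨ρ, ⟨h0, h1⟩, hρ⟩ := hroot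
  refine ⟨ρ, h0, h1, ?_⟩
  have h2 : (1 - ρ) ^ 4 ≠ 0 := pow_ne_zero _ (by linarith)
  refine (mul_eq_zero.1 (?_ : (1 - ρ) ^ 4 * _ = 0)).resolve_left h2
  have hinv : ∀ m, (attractionDFT (2 * n) ρ⁻¹ m).re =
      -ρ ^ 2 * (attractionDFT (2 * n) ρ (-m - 1)).re := by
    intro m
    rw [attractionDFT_inv_re _ (inv_pos.2 h0), inv_inv, inv_pow, inv_inv]
  rw [hinv, hinv]
  simp only [hH, regularizedDFT_eq _ _ h1] at hρ
  linear_combination hρ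

theorem exists_really_perverse {n : ℕ} (hn : 237 ≤ n) :
    ∃ (x : Body n → ℂ) (X : ℝ → Body n → ℂ) (μ μ' : Fin 4 → ℝ),
      IsPolygonConfiguration n x ∧ IsUniformRotation x X ∧ (∀ k, 0 < μ k) ∧ (∀ k, 0 < μ' k) ∧
      AreReallyAdmissible (polygonMasses n μ) (polygonMasses n μ') X := by
  have : NeZero (2 * n) := ⟨by omega⟩
  have hn2 : 2 ≤ n := by omega
  obtain ⟨ρ, h0, h1, hdet⟩ := exists_degenerate_radius hn
  have hκ := attractionDFT_one_re_pos n n le_rfl (by omega)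
  have hΓ := attractionDFT_one_zero_re (2 * n)
  have hA := lt_polygonAttraction (N := 2 * n) (by omega)
  have hs := attractionDFT_re_neg (2 * n) h0 h1 n
  have hu := attractionDFT_re_neg (2 * n) h0 h1 0
  have hv := attractionDFT_re_pos (2 * n) ((one_lt_inv₀ h0).2 h1) 0
  have ht := attractionDFT_re_pos (2 * n) ((one_lt_inv₀ h0).2 h1) n
  have hc := attractionDFT_one_zero_re_neg (2 * n) (by omega)
  have hsol := fun (μ : Fin 4 → ℝ) (ω : ℝ) =>
    isNBodySolution_polygonConfiguration (μ := μ) (ω := ω) hn2 h0 h1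
  set c := (attractionDFT (2 * n) 1 0).re
  set κ := (attractionDFT (2 * n) 1 n).re
  set s := (attractionDFT (2 * n) ρ n).re
  set u := (attractionDFT (2 * n) ρ 0).re
  set v := (attractionDFT (2 * n) ρ⁻¹ 0).re
  set t := (attractionDFT (2 * n) ρ⁻¹ n).re
  have hNn : ((2 * n : ℕ) : ℝ) = 2 * n := by push_cast; ring
  set N : ℝ := ((2 * n : ℕ) : ℝ)
  have hA' : N + c < 0 := by linarith
  have hρ3 : 0 < 1 - ρ ^ 3 := by
    have := pow_lt_one₀ h0.le h1 (by norm_num : (3 : ℕ) ≠ 0)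
    linarith
  -- a system of positive masses
  obtain ⟨a, ha, ha'⟩ := exists_pos_mul_lt
    (lt_min (mul_pos (pow_pos h0 3) (neg_pos.2 hc)) hκ) (|c + κ| + |s|)
  have ha1 : a * |c + κ| < ρ ^ 3 * -c := by
    have := ha'.trans_le (min_le_left _ _)
    nlinarith [mul_nonneg ha.le (abs_nonneg s)]
  have ha2 : a * |s| < κ := by
    have := ha'.trans_le (min_le_right _ _)
    nlinarith [mul_nonneg ha.le (abs_nonneg (c + κ))]
  -- Determined by mode `n` of the outer equations.
  set b := -(a * s) / (2 * κ) with hb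
  have hbκ : b * κ = -(a * s) / 2 := by rw [hb]; field_simp
  have hb0 : 0 < b := by
    rw [hb]; apply div_pos _ (by positivity); nlinarith
  have hb1 : b < 1 := by
    rw [hb, div_lt_one (by positivity)]
    rw [abs_of_neg hs] at ha2
    linarith
  -- The central mass obtained by eliminating `ω ^ 2` between the outer mode-`0` equation and the
  -- inner one.
  set M := (a / 2 * (c + κ) + v + b * t + ρ ^ 3 * (-c - a / 2 * u)) / (1 - ρ ^ 3) with hM
  have hMeq : M * (1 - ρ ^ 3) = a / 2 * (c + κ) + v + b * t + ρ ^ 3 * (-c - a / 2 * u) := by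
    rw [hM]; field_simp
  have hM0 : 0 < M := by
    rw [hM]
    apply div_pos _ hρ3
    have e1 := mul_le_mul_of_nonneg_left (neg_abs_le (c + κ)) ha.le
    have e2 : 0 < b * t := mul_pos hb0 ht
    have e3 : 0 < ρ ^ 3 * (a * -u) := mul_pos (pow_pos h0 3) (mul_pos ha (neg_pos.2 hu))
    have e4 : 0 < ρ ^ 3 * -c := mul_pos (pow_pos h0 3) (neg_pos.2 hc)
    nlinarith
  set ω := Real.sqrt (M - a / 2 * u - c) with hω
  have hω2 : ω ^ 2 = M - a / 2 * u - c := by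
    rw [hω, Real.sq_sqrt]
    nlinarith [mul_pos ha (neg_pos.2 hu)]
  -- a system of masses of total zero which exerts no force
  set p := -u / (2 * (N + c)) - N / (2 * (N + c)) with hp
  set q := -s / (2 * κ) with hq
  have hpA : p * (N + c) = -(N + u) / 2 := by
    have := hA'.ne
    rw [hp]; field_simp; ring
  have hqκ : q * κ = -s / 2 := by rw [hq]; field_simp
  -- With perturbation `1` on the `n`-gon and `p ± q` on the `2n`-gon, the outer equations fix `p`
  -- and `q`. The inner equation is then the vanishing of the determinant, divided by `2 * (N + c) *
  -- κ`.
  have hkey : (N + c + κ) / 2 + p * (N + v) + q * t = 0 := by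
    have h3 : (N + c) * κ ≠ 0 := (mul_neg_of_neg_of_pos hA' hκ).ne
    refine (mul_eq_zero.1 (?_ : (N + c) * κ * _ = 0)).resolve_left h3
    linear_combination hdet / 2 + (N + v) * κ * hpA + t * (N + c) * hqκ
  set δ₀ := -n - N * p with hδ₀
  -- The force-free system is scaled by `η`, small enough to keep every mass positive.
  obtain ⟨η, hη, hη'⟩ := exists_pos_mul_lt
    (lt_min hM0 (lt_min ha (lt_min (by linarith : 0 < 1 + b) (by linarith : 0 < 1 - b))))
    (|δ₀| + |p| + |q|)
  have hsmall : ∀ y z : ℝ, |y| ≤ |δ₀| + |p| + |q| →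
      min M (min a (min (1 + b) (1 - b))) ≤ z → 0 < z + η * y := by
    intro y z hy hz
    have e1 := mul_le_mul_of_nonneg_left hy hη.le
    have e2 := mul_le_mul_of_nonneg_left (neg_abs_le y) hη.le
    linarith
  set μ : Fin 4 → ℝ := ![M, a, 1 + b, 1 - b] with hμ
  set μ' : Fin 4 → ℝ := ![M + η * δ₀, a + η, 1 + b + η * (p + q), 1 - b + η * (p - q)] with hμ'
  have hsum : ∑ i, polygonMasses n μ' i = ∑ i, polygonMasses n μ i := by
    rw [sum_polygonMasses, sum_polygonMasses]
    simp only [hμ, hμ', hδ₀, Matrix.cons_val]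
    linear_combination -η * p * hNn
  refine ⟨polygonConfiguration n ρ,
    fun t i => exp (I * (ω * t : ℝ)) * polygonConfiguration n ρ i, μ, μ',
    isPolygonConfiguration_polygonConfiguration n h0, ⟨ω, fun _ _ => rfl⟩, ?_, ?_,
    hsol μ ω ?_ ?_ ?_, hsol μ' ω ?_ ?_ ?_, ?_, hsum, fun τ => ?_⟩
  · simp only [hμ, Fin.forall_fin_succ]
    simp
    exact ⟨hM0, ha, by linarith, hb1⟩
  · have k0 := hsmall δ₀ M (by linarith [abs_nonneg p, abs_nonneg q]) (min_le_left _ _)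
    have k2 := hsmall (p + q) (1 + b) (by linarith [abs_add_le p q, abs_nonneg δ₀])
      ((min_le_right _ _).trans ((min_le_right _ _).trans (min_le_left _ _)))
    have k3 := hsmall (p - q) (1 - b) (by linarith [abs_sub p q, abs_nonneg δ₀])
      ((min_le_right _ _).trans ((min_le_right _ _).trans (min_le_right _ _)))
    intro k
    fin_cases k
    · exact k0
    · exact add_pos ha hη
    · exact k2
    · exact k3
  · simp only [hμ, Matrix.cons_val]
    linear_combination hω2
  · simp only [hμ, Matrix.cons_val]
    linear_combination hbκ
  · simp only [hμ, Matrix.cons_val]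
    linear_combination ρ ^ 3 * hω2 - hMeq
  · simp only [hμ', Matrix.cons_val]
    linear_combination hω2 + η * hpA - η * hNn / 2
  · simp only [hμ', Matrix.cons_val]
    linear_combination hbκ + η * hqκ
  · simp only [hμ', Matrix.cons_val]
    linear_combination ρ ^ 3 * hω2 - hMeq + η * hkey - η * hNn / 2
  · intro h
    have := congrFun h (Sum.inr (Sum.inl ⟨0, by omega⟩))
    simp only [polygonMasses, hμ, hμ', Matrix.cons_val] at this
    linarith
  · rw [centerMass_polygonMasses hn2, centerMass_polygonMasses hn2]

end

theorem theorem1 (n : ℕ) (hn : 2 ≤ n) :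
    (237 ≤ n →
      ∃ (x : Body n → ℂ) (X : ℝ → Body n → ℂ) (μ μ' : Fin 4 → ℝ),
        IsPolygonConfiguration n x ∧ IsUniformRotation x X ∧
        (∀ k, 0 < μ k) ∧ (∀ k, 0 < μ' k) ∧
        IsReallyPerverse (polygonMasses n μ) X ∧
        AreReallyAdmissible (polygonMasses n μ) (polygonMasses n μ') X) ∧
    (n ≤ 236 →
      ¬ ∃ (x : Body n → ℂ) (X : ℝ → Body n → ℂ) (μ : Fin 4 → ℝ),
        IsPolygonConfiguration n x ∧ IsUniformRotation x X ∧
        IsReallyPerverse (polygonMasses n μ) X) := by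
  constructor
  · intro h
    obtain ⟨x, X, μ, μ', h1, h2, h3, h4, h5⟩ := exists_really_perverse h
    exact ⟨x, X, μ, μ', h1, h2, h3, h4, ⟨_, h5⟩, h5⟩
  · rintro h ⟨x, X, μ, hx, hX, hp⟩
    exact not_isReallyPerverse hn h hx hX hp
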